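/- Let $N\ge 0$ and let $\Omega\subset\mathbb{R}^N$ be an open set (for instance a bounded domain with smooth boundary). Let $a:\Omega\times\mathbb{R}\to\mathbb{R}$, put $\varphi(x,t)=a(x,|t|)t$ for $t\ne 0$, $\varphi(x,0)=0$, and $\Phi(x,t)=\int_0^t\varphi(x,s)\,ds$. Assume that - for every $x\in\Omega$, $\varphi(x,\cdot)$ is an odd, increasing homeomorphism of $\mathbb{R}$ onto $\mathbb{R}$; - for every $t\ge 0$, $\Phi(\cdot,t)$ is measurable on $\Omega$; - there are constants $\varphi_0,\varphi^0$ with $1<\varphi_0\le \dfrac{t\,\varphi(x,t)}{\Phi(x,t)}\le\varphi^0<\infty$ for all $x\in\Omega$, $t>0$; - for every $x\in\Omega$, the function $[0,\infty)\ni t\mapsto\Phi(x,\sqrt t)$ is convex. Let $L^\Phi(\Omega)$ be the space of measurable functions $u$ on $\Omega$ with $\lim_{\lambda\to0^+}\int_\Omega\Phi(x,\lambda|u(x)|)\,dx=0$, and let $E=W^{1,\Phi}(\Omega)$ be the space of all $u\in L^\Phi(\Omega)\cap L^1_{\rm loc}(\Omega)$ that have a weak gradient $\nabla u\in L^1_{\rm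 loc}(\Omega)^N$ with $|\nabla u|\in L^\Phi(\Omega)$ (functions equal almost everywhere being identified), with the norm $$\|u\|=\inf\Big\{\mu>0:\ \int_\Omega\Big[\Phi\Big(x,\frac{|u(x)|}{\mu}\Big)+\Phi\Big(x,\frac{|\nabla u(x)|}{\mu}\Big)\Big]dx\le 1\Big\}.$$ Define $\Lambda:E\to\mathbb{R}$ by $\Lambda(u)=\int_\Omega[\Phi(x,|\nabla u(x)|)+\Phi(x,|u(x)|)]\,dx$, and let $\Lambda'$ be its Fréchet derivative. If a sequence $(u_n)$ in $E$ converges weakly to $u\in E$ and $$\limsup_{n\to\infty}\,\langle\Lambda'(u_n),u_n-u\rangle\le 0,$$ then $(u_n)$ converges strongly to $u$ in $E$. -/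

import Mathlib

open MeasureTheory Filter Topology

noncomputable section

namespace OrliczSobolev

/-- Euclidean space `ℝᴺ` with its Euclidean norm. -/
abbrev Vec (N : ℕ) := EuclideanSpace ℝ (Fin N)

variable {N : ℕ}

/-- `φ(x,t) = a(x,|t|) t` for `t ≠ 0` and `φ(x,0) = 0`. -/
def phi (a : Vec N → ℝ → ℝ) (x : Vec N) (t : ℝ) : ℝ :=
  if t = 0 then 0 else a x |t| * t

/-- `Φ(x,t) = ∫₀ᵗ φ(x,s) ds`. -/
def bigPhi (a : Vec N → ℝ → ℝ) (x : Vec N) (t : ℝ) : ℝ :=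
  ∫ s in (0 : ℝ)..t, phi a x s

/-- Lebesgue measure on the open set `Ω`. -/
abbrev vol (Ω : TopologicalSpace.Opens (Vec N)) : Measure (Vec N) :=
  volume.restrict (Ω : Set (Vec N))

/-- The structural hypotheses on `a`, that is on `φ` and `Φ`, over the open set `Ω`. -/
structure IsAdmissible (Ω : TopologicalSpace.Opens (Vec N)) (a : Vec N → ℝ → ℝ) : Prop where
  odd : ∀ x ∈ Ω, (phi a x).Odd
  strictMono : ∀ x ∈ Ω, StrictMono (phi a x)
  isHomeomorph : ∀ x ∈ Ω, IsHomeomorph (phi a x)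
  /-- `Φ(·,t)` is Lebesgue measurable on `Ω` for every `t ≥ 0`. -/
  measurable : ∀ t : ℝ, 0 ≤ t → AEMeasurable (fun x => bigPhi a x t) (vol Ω)
  growth : ∃ φ₀ φ₁ : ℝ, 1 < φ₀ ∧ ∀ x ∈ Ω, ∀ t : ℝ, 0 < t →
    φ₀ ≤ t * phi a x t / bigPhi a x t ∧ t * phi a x t / bigPhi a x t ≤ φ₁
  convex_sqrt : ∀ x ∈ Ω, ConvexOn ℝ (Set.Ici 0) (fun t : ℝ => bigPhi a x (√t))

/-- The modular `∫_Ω Φ(x,|f(x)|) dx ∈ [0,∞]` of a scalar or vector valued function. -/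
def modular (Ω : TopologicalSpace.Opens (Vec N)) (a : Vec N → ℝ → ℝ)
    {F : Type*} [NormedAddCommGroup F] (f : Vec N → F) : ENNReal :=
  ∫⁻ x, ENNReal.ofReal (bigPhi a x ‖f x‖) ∂(vol Ω)

/-- `f ∈ L^Φ(Ω)` (for vector valued `f`: `|f| ∈ L^Φ(Ω)`): `f` is measurable and
`∫_Ω Φ(x, c|f(x)|) dx → 0` as `c → 0⁺`. -/
def MemLPhi (Ω : TopologicalSpace.Opens (Vec N)) (a : Vec N → ℝ → ℝ)
    {F : Type*} [NormedAddCommGroup F] [NormedSpace ℝ F] (f : Vec N → F) : Prop :=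
  AEStronglyMeasurable f (vol Ω) ∧
    Tendsto (fun c : ℝ => modular Ω a (fun x => c • f x)) (𝓝[>] 0) (𝓝 0)

/-- `f ∈ L¹_loc(Ω)`. -/
def LocInt (Ω : TopologicalSpace.Opens (Vec N)) {F : Type*} [NormedAddCommGroup F]
    (f : Vec N → F) : Prop :=
  ∀ K : Set (Vec N), IsCompact K → K ⊆ Ω → IntegrableOn f K volume

/-- `g` is the weak (distributional) gradient of `u` in `Ω`. -/
def HasWeakGradient (Ω : TopologicalSpace.Opens (Vec N)) (u : Vec N → ℝ)
    (g : Vec N → Vec N) : Prop :=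
  LocInt Ω u ∧ LocInt Ω g ∧
    ∀ ψ : Vec N → ℝ, ContDiff ℝ (⊤ : ℕ∞) ψ → HasCompactSupport ψ → tsupport ψ ⊆ Ω →
      ∀ i : Fin N, ∫ x, u x * fderiv ℝ ψ x (EuclideanSpace.single i 1) ∂(vol Ω)
        = - ∫ x, g x i * ψ x ∂(vol Ω)

section Facts

variable {Ω : TopologicalSpace.Opens (Vec N)} {a : Vec N → ℝ → ℝ}

lemma phi_zero (x : Vec N) : phi a x 0 = 0 := by simp [phi]

lemma bigPhi_zero (x : Vec N) : bigPhi a x 0 = 0 := by simp [bigPhi]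

namespace IsAdmissible

lemma hasDerivAt (h : IsAdmissible Ω a) {x : Vec N} (hx : x ∈ Ω) (t : ℝ) :
    HasDerivAt (bigPhi a x) (phi a x t) t :=
  intervalIntegral.integral_hasDerivAt_right
    ((h.isHomeomorph x hx).continuous.intervalIntegrable _ _)
    ((h.isHomeomorph x hx).continuous.stronglyMeasurableAtFilter _ _)
    (h.isHomeomorph x hx).continuous.continuousAt

lemma continuous (h : IsAdmissible Ω a) {x : Vec N} (hx : x ∈ Ω) : Continuous (bigPhi a x) :=
  continuous_iff_continuousAt.2 fun t => (h.hasDerivAt hx t).continuousAt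

lemma convexOn (h : IsAdmissible Ω a) {x : Vec N} (hx : x ∈ Ω) :
    ConvexOn ℝ Set.univ (bigPhi a x) := by
  refine Monotone.convexOn_univ_of_deriv (fun t => (h.hasDerivAt hx t).differentiableAt) ?_
  have : deriv (bigPhi a x) = phi a x := funext fun t => (h.hasDerivAt hx t).deriv
  rw [this]
  exact (h.strictMono x hx).monotone

lemma strictMonoOn (h : IsAdmissible Ω a) {x : Vec N} (hx : x ∈ Ω) :
    StrictMonoOn (bigPhi a x) (Set.Ici 0) := by
  refine strictMonoOn_of_deriv_pos (convex_Ici 0) (h.continuous hx).continuousOn ?_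
  intro t ht
  rw [interior_Ici] at ht
  rw [(h.hasDerivAt hx t).deriv, ← phi_zero (a := a) x]
  exact h.strictMono x hx ht

lemma mono (h : IsAdmissible Ω a) {x : Vec N} (hx : x ∈ Ω) {s t : ℝ} (hs : 0 ≤ s)
    (hst : s ≤ t) : bigPhi a x s ≤ bigPhi a x t :=
  (h.strictMonoOn hx).monotoneOn hs (hs.trans hst) hst

lemma nonneg (h : IsAdmissible Ω a) {x : Vec N} (hx : x ∈ Ω) {t : ℝ} (ht : 0 ≤ t) :
    0 ≤ bigPhi a x t := by
  rw [← bigPhi_zero (a := a) x]; exact h.mono hx le_rfl ht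

lemma eq_zero (h : IsAdmissible Ω a) {x : Vec N} (hx : x ∈ Ω) {t : ℝ} (ht : 0 ≤ t)
    (h0 : bigPhi a x t = 0) : t = 0 := by
  by_contra hne
  have := h.strictMonoOn hx (Set.mem_Ici.2 le_rfl) ht (lt_of_le_of_ne ht (Ne.symm hne))
  rw [bigPhi_zero] at this
  exact this.ne' h0

/-- Measurability of `x ↦ Φ(x, v(x))`. -/
lemma aemeasurable_comp (h : IsAdmissible Ω a) {v : Vec N → ℝ} (hv : AEMeasurable v (vol Ω))
    (hv0 : ∀ x, 0 ≤ v x) : AEMeasurable (fun x => bigPhi a x (v x)) (vol Ω) := by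
  set w : Vec N → ℝ := fun x => max (hv.mk v x) 0 with hw
  have hwm : Measurable w := hv.measurable_mk.max measurable_const
  have hvw : (fun x => bigPhi a x (w x)) =ᵐ[vol Ω] fun x => bigPhi a x (v x) := by
    filter_upwards [hv.ae_eq_mk] with x hx
    simp only [hw, ← hx, max_eq_left (hv0 x)]
  refine AEMeasurable.congr ?_ hvw
  let s : ℕ → SimpleFunc (Vec N) ℝ :=
    SimpleFunc.approxOn w hwm (Set.Ici 0) 0 (Set.mem_Ici.2 le_rfl)
  have hs0 : ∀ n x, 0 ≤ s n x := fun n x => SimpleFunc.approxOn_mem hwm _ n x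
  refine aemeasurable_of_tendsto_metrizable_ae atTop
    (f := fun n x => bigPhi a x (s n x)) (fun n => ?_) ?_
  · have : (fun x => bigPhi a x (s n x)) = fun x =>
        ∑ c ∈ (s n).range, (s n ⁻¹' {c}).indicator (fun x => bigPhi a x c) x := by
      funext x
      rw [Finset.sum_eq_single (s n x)]
      · simp
      · intro c _ hc
        exact Set.indicator_of_notMem (fun hx => hc (by simpa using hx.symm)) _
      · intro hx
        exact absurd ((s n).mem_range_self x) hx
    rw [this]
    refine Finset.aemeasurable_fun_sum _ fun c hc => ?_
    obtain ⟨y, rfl⟩ := SimpleFunc.mem_range.1 hc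
    exact (h.measurable _ (hs0 n y)).indicator ((s n).measurableSet_fiber _)
  · filter_upwards [ae_restrict_mem Ω.isOpen.measurableSet] with x hx
    refine ((h.continuous hx).tendsto _).comp ?_
    refine SimpleFunc.tendsto_approxOn hwm _ (subset_closure ?_)
    exact (le_max_right (hv.mk v x) 0 : (0 : ℝ) ≤ _)

end IsAdmissible

lemma ae_mem (Ω : TopologicalSpace.Opens (Vec N)) : ∀ᵐ x ∂(vol Ω), x ∈ Ω :=
  ae_restrict_mem Ω.isOpen.measurableSet

section MemLPhi

variable {F : Type*} [NormedAddCommGroup F]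

lemma modular_aemeasurable (h : IsAdmissible Ω a) {f : Vec N → F}
    (hf : AEStronglyMeasurable f (vol Ω)) :
    AEMeasurable (fun x => ENNReal.ofReal (bigPhi a x ‖f x‖)) (vol Ω) :=
  (h.aemeasurable_comp hf.norm.aemeasurable fun _ => norm_nonneg _).ennreal_ofReal

variable [NormedSpace ℝ F]

lemma MemLPhi.congr {f g : Vec N → F} (hf : MemLPhi Ω a f) (hfg : f =ᵐ[vol Ω] g) :
    MemLPhi Ω a g := by
  refine ⟨hf.1.congr hfg, hf.2.congr fun c => lintegral_congr_ae ?_⟩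
  filter_upwards [hfg] with x hx
  rw [hx]

lemma MemLPhi.zero : MemLPhi Ω a (0 : Vec N → F) := by
  refine ⟨aestronglyMeasurable_zero, ?_⟩
  have : ∀ c : ℝ, modular Ω a (fun x => c • (0 : Vec N → F) x) = 0 := by
    intro c
    simp [modular, bigPhi_zero]
  simp only [this]
  exact tendsto_const_nhds

lemma MemLPhi.add (h : IsAdmissible Ω a) {f g : Vec N → F} (hf : MemLPhi Ω a f)
    (hg : MemLPhi Ω a g) : MemLPhi Ω a (f + g) := by
  refine ⟨hf.1.add hg.1, ?_⟩
  have hd : Tendsto (fun c : ℝ => 2 * c) (𝓝[>] 0) (𝓝[>] 0) := by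
    refine tendsto_nhdsWithin_iff.2 ⟨?_, ?_⟩
    · have : Tendsto (fun c : ℝ => 2 * c) (𝓝 0) (𝓝 (2 * 0)) :=
        (continuous_const.mul continuous_id).tendsto 0
      rw [mul_zero] at this
      exact this.mono_left nhdsWithin_le_nhds
    · filter_upwards [self_mem_nhdsWithin] with c hc
      exact mul_pos two_pos (Set.mem_Ioi.1 hc)
  have hsum := (hf.2.comp hd).add (hg.2.comp hd)
  rw [add_zero] at hsum
  refine tendsto_of_tendsto_of_tendsto_of_le_of_le tendsto_const_nhds hsum
    (fun _ => zero_le) fun c => ?_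
  simp only [modular, Function.comp]
  rw [← lintegral_add_left' (modular_aemeasurable h
    (f := fun x => (2 * c) • f x) (hf.1.const_smul (2 * c)))]
  refine lintegral_mono_ae ?_
  filter_upwards [ae_mem Ω] with x hx
  have hle : ‖c • (f + g) x‖ ≤ max ‖(2 * c) • f x‖ ‖(2 * c) • g x‖ := by
    have h1 : ‖c • (f + g) x‖ ≤ ‖c • f x‖ + ‖c • g x‖ := by
      rw [Pi.add_apply, smul_add]; exact norm_add_le _ _
    have h2 : ‖(2 * c) • f x‖ = 2 * ‖c • f x‖ := by rw [mul_smul, norm_smul]; simp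
    have h3 : ‖(2 * c) • g x‖ = 2 * ‖c • g x‖ := by rw [mul_smul, norm_smul]; simp
    rw [h2, h3]
    rcases le_total ‖c • f x‖ ‖c • g x‖ with h4 | h4
    · exact le_max_of_le_right (by linarith)
    · exact le_max_of_le_left (by linarith)
  rcases le_max_iff.1 hle with h4 | h4
  · exact (ENNReal.ofReal_le_ofReal (h.mono hx (norm_nonneg _) h4)).trans le_self_add
  · exact (ENNReal.ofReal_le_ofReal (h.mono hx (norm_nonneg _) h4)).trans le_add_self

lemma MemLPhi.smul {f : Vec N → F} (hf : MemLPhi Ω a f) (r : ℝ) : MemLPhi Ω a (r • f) := by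
  by_cases hr : r = 0
  · subst hr
    rw [zero_smul]
    exact MemLPhi.zero
  refine ⟨hf.1.const_smul r, ?_⟩
  have hd : Tendsto (fun c : ℝ => |r| * c) (𝓝[>] 0) (𝓝[>] 0) := by
    refine tendsto_nhdsWithin_iff.2 ⟨?_, ?_⟩
    · have : Tendsto (fun c : ℝ => |r| * c) (𝓝 0) (𝓝 (|r| * 0)) :=
        (continuous_const.mul continuous_id).tendsto 0
      rw [mul_zero] at this
      exact this.mono_left nhdsWithin_le_nhds
    · filter_upwards [self_mem_nhdsWithin] with c hc
      exact mul_pos (abs_pos.2 hr) (Set.mem_Ioi.1 hc)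
  refine (hf.2.comp hd).congr fun c => ?_
  simp only [modular, Function.comp]
  refine lintegral_congr fun x => ?_
  congr 2
  simp only [Pi.smul_apply, norm_smul, norm_mul, Real.norm_eq_abs, abs_abs]
  ring

end MemLPhi

section WeakGradient

variable {F : Type*} [NormedAddCommGroup F]

lemma LocInt.congr {f g : Vec N → F} (hf : LocInt Ω f) (hfg : f =ᵐ[vol Ω] g) : LocInt Ω g :=
  fun K hK hKΩ => (hf K hK hKΩ).congr (ae_restrict_of_ae_restrict_of_subset hKΩ hfg)

/-- The product of a locally integrable function with a continuous function that is supported in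
a compact subset of `Ω` is integrable. -/
lemma LocInt.integrable_mul {f : Vec N → ℝ} (hf : LocInt Ω f) {ψ : Vec N → ℝ}
    (hψ : Continuous ψ) (hc : HasCompactSupport ψ) (hs : tsupport ψ ⊆ Ω) :
    Integrable (fun x => f x * ψ x) (vol Ω) := by
  have h1 : IntegrableOn (fun x => f x * ψ x) (tsupport ψ) volume :=
    (hf _ hc hs).mul_continuousOn hψ.continuousOn hc
  have h2 : Function.support (fun x => f x * ψ x) ⊆ tsupport ψ := fun x hx =>
    subset_tsupport ψ (right_ne_zero_of_mul hx)
  exact ((integrableOn_iff_integrable_of_support_subset h2).1 h1).integrableOn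

lemma LocInt.coord {g : Vec N → Vec N} (hg : LocInt Ω g) (i : Fin N) :
    LocInt Ω (fun x => g x i) := fun K hK hKΩ =>
  (EuclideanSpace.proj (𝕜 := ℝ) i).integrable_comp (hg K hK hKΩ)

lemma integrable_left {u : Vec N → ℝ} (hu : LocInt Ω u) {ψ : Vec N → ℝ}
    (hψ : ContDiff ℝ (⊤ : ℕ∞) ψ) (hc : HasCompactSupport ψ) (hs : tsupport ψ ⊆ Ω) (e : Vec N) :
    Integrable (fun x => u x * fderiv ℝ ψ x e) (vol Ω) := by
  have hsub : tsupport (fun x => fderiv ℝ ψ x e) ⊆ tsupport ψ := by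
    refine closure_minimal (fun x hx => ?_) (isClosed_tsupport ψ)
    refine support_fderiv_subset ℝ (f := ψ) fun h0 => hx ?_
    simp [h0]
  refine hu.integrable_mul ?_ ?_ (hsub.trans hs)
  · exact (hψ.continuous_fderiv (by simp)).clm_apply continuous_const
  · exact hc.mono' ((subset_tsupport _).trans hsub)

lemma HasWeakGradient.congr {u u' : Vec N → ℝ} {g g' : Vec N → Vec N}
    (hw : HasWeakGradient Ω u g) (hu : u =ᵐ[vol Ω] u') (hg : g =ᵐ[vol Ω] g') :
    HasWeakGradient Ω u' g' := by
  refine ⟨hw.1.congr hu, hw.2.1.congr hg, fun ψ h1 h2 h3 i => ?_⟩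
  have e1 : ∫ x, u' x * fderiv ℝ ψ x (EuclideanSpace.single i 1) ∂(vol Ω)
      = ∫ x, u x * fderiv ℝ ψ x (EuclideanSpace.single i 1) ∂(vol Ω) := by
    refine integral_congr_ae ?_
    filter_upwards [hu] with x hx
    rw [hx]
  have e2 : ∫ x, g' x i * ψ x ∂(vol Ω) = ∫ x, g x i * ψ x ∂(vol Ω) := by
    refine integral_congr_ae ?_
    filter_upwards [hg] with x hx
    rw [hx]
  rw [e1, e2]
  exact hw.2.2 ψ h1 h2 h3 i

lemma HasWeakGradient.zero : HasWeakGradient Ω 0 0 :=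
  ⟨fun _ _ _ => integrableOn_zero, fun _ _ _ => integrableOn_zero, fun _ _ _ _ _ => by simp⟩

lemma HasWeakGradient.add {u u' : Vec N → ℝ} {g g' : Vec N → Vec N}
    (hw : HasWeakGradient Ω u g) (hw' : HasWeakGradient Ω u' g') :
    HasWeakGradient Ω (u + u') (g + g') := by
  refine ⟨fun K h1 h2 => (hw.1 K h1 h2).add (hw'.1 K h1 h2),
    fun K h1 h2 => (hw.2.1 K h1 h2).add (hw'.2.1 K h1 h2), fun ψ h1 h2 h3 i => ?_⟩
  simp only [Pi.add_apply, PiLp.add_apply, add_mul]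
  rw [integral_add (integrable_left hw.1 h1 h2 h3 _) (integrable_left hw'.1 h1 h2 h3 _),
    integral_add ((hw.2.1.coord i).integrable_mul h1.continuous h2 h3)
      ((hw'.2.1.coord i).integrable_mul h1.continuous h2 h3),
    hw.2.2 ψ h1 h2 h3 i, hw'.2.2 ψ h1 h2 h3 i]
  ring

lemma HasWeakGradient.smul {u : Vec N → ℝ} {g : Vec N → Vec N}
    (hw : HasWeakGradient Ω u g) (r : ℝ) : HasWeakGradient Ω (r • u) (r • g) := by
  refine ⟨fun K h1 h2 => (hw.1 K h1 h2).smul r, fun K h1 h2 => (hw.2.1 K h1 h2).smul r,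
    fun ψ h1 h2 h3 i => ?_⟩
  simp only [Pi.smul_apply, PiLp.smul_apply, smul_eq_mul, mul_assoc]
  rw [integral_const_mul, integral_const_mul, hw.2.2 ψ h1 h2 h3 i]
  ring

/-- The weak gradient is unique, so that an element of the Sobolev space is determined by its
function. -/
lemma HasWeakGradient.unique {u : Vec N → ℝ} {g g' : Vec N → Vec N}
    (hw : HasWeakGradient Ω u g) (hw' : HasWeakGradient Ω u g') : g =ᵐ[vol Ω] g' := by
  have key : ∀ i : Fin N, ∀ᵐ x ∂(volume : Measure (Vec N)),
      x ∈ (Ω : Set (Vec N)) → g x i - g' x i = 0 := by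
    intro i
    refine IsOpen.ae_eq_zero_of_integral_contDiff_smul_eq_zero Ω.isOpen ?_ fun ψ h1 h2 h3 => ?_
    · refine (locallyIntegrableOn_iff Ω.isOpen.isLocallyClosed).2 fun K hKΩ hK => ?_
      exact (hw.2.1.coord i K hK hKΩ).sub (hw'.2.1.coord i K hK hKΩ)
    · have e := (hw.2.2 ψ h1 h2 h3 i).symm.trans (hw'.2.2 ψ h1 h2 h3 i)
      have e2 : ∫ x, ψ x • (g x i - g' x i) ∂(vol Ω) = 0 := by
        have : (fun x => ψ x • (g x i - g' x i)) = fun x => g x i * ψ x - g' x i * ψ x := by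
          funext x; simp only [smul_eq_mul]; ring
        rw [this, integral_sub ((hw.2.1.coord i).integrable_mul h1.continuous h2 h3)
          ((hw'.2.1.coord i).integrable_mul h1.continuous h2 h3)]
        linarith
      rw [← e2]
      refine (setIntegral_eq_integral_of_forall_compl_eq_zero fun x hx => ?_).symm
      rw [image_eq_zero_of_notMem_tsupport fun hx' => hx (h3 hx'), zero_smul]
  have hall := (ae_restrict_iff' Ω.isOpen.measurableSet).2 (ae_all_iff.2 key |>.mono
    fun x hx hxΩ i => hx i hxΩ)
  filter_upwards [hall] with x hx
  ext i
  exact sub_eq_zero.1 (hx i)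

end WeakGradient

end Facts

/-- The pairs `(u, ∇u)`, up to equality almost everywhere in `Ω`, where `u ∈ L^Φ(Ω)` has a weak
gradient `∇u` with `|∇u| ∈ L^Φ(Ω)`. -/
def sobolevSubmodule {Ω : TopologicalSpace.Opens (Vec N)} {a : Vec N → ℝ → ℝ}
    (h : IsAdmissible Ω a) :
    Submodule ℝ ((Vec N →ₘ[vol Ω] ℝ) × (Vec N →ₘ[vol Ω] Vec N)) where
  carrier := {p | MemLPhi Ω a p.1 ∧ MemLPhi Ω a p.2 ∧ HasWeakGradient Ω p.1 p.2}
  add_mem' := by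
    rintro p q ⟨hp1, hp2, hp3⟩ ⟨hq1, hq2, hq3⟩
    exact ⟨(hp1.add h hq1).congr (AEEqFun.coeFn_add _ _).symm,
      (hp2.add h hq2).congr (AEEqFun.coeFn_add _ _).symm,
      (hp3.add hq3).congr (AEEqFun.coeFn_add _ _).symm (AEEqFun.coeFn_add _ _).symm⟩
  zero_mem' := ⟨MemLPhi.zero.congr AEEqFun.coeFn_zero.symm,
    MemLPhi.zero.congr AEEqFun.coeFn_zero.symm,
    HasWeakGradient.zero.congr AEEqFun.coeFn_zero.symm AEEqFun.coeFn_zero.symm⟩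
  smul_mem' := by
    rintro r p ⟨hp1, hp2, hp3⟩
    exact ⟨(hp1.smul r).congr (AEEqFun.coeFn_smul _ _).symm,
      (hp2.smul r).congr (AEEqFun.coeFn_smul _ _).symm,
      (hp3.smul r).congr (AEEqFun.coeFn_smul _ _).symm (AEEqFun.coeFn_smul _ _).symm⟩

/-- The generalized Orlicz-Sobolev space `W^{1,Φ}(Ω)`. An element is recorded together with its
weak gradient, which it determines (`HasWeakGradient.unique`). -/
def W1Phi {Ω : TopologicalSpace.Opens (Vec N)} {a : Vec N → ℝ → ℝ}
    (h : IsAdmissible Ω a) : Type :=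
  ↥(sobolevSubmodule h)

namespace W1Phi

variable {Ω : TopologicalSpace.Opens (Vec N)} {a : Vec N → ℝ → ℝ} {h : IsAdmissible Ω a}

instance : AddCommGroup (W1Phi h) := inferInstanceAs (AddCommGroup ↥(sobolevSubmodule h))

instance : Module ℝ (W1Phi h) := inferInstanceAs (Module ℝ ↥(sobolevSubmodule h))

/-- The function underlying an element of `W^{1,Φ}(Ω)`. -/
def fn (u : W1Phi h) : Vec N → ℝ := (Subtype.val u).1

/-- The weak gradient of an element of `W^{1,Φ}(Ω)`. -/
def grad (u : W1Phi h) : Vec N → Vec N := (Subtype.val u).2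

lemma memLPhi_fn (u : W1Phi h) : MemLPhi Ω a u.fn := u.2.1

lemma memLPhi_grad (u : W1Phi h) : MemLPhi Ω a u.grad := u.2.2.1

lemma fn_add (u v : W1Phi h) : (u + v).fn =ᵐ[vol Ω] u.fn + v.fn := AEEqFun.coeFn_add _ _

lemma grad_add (u v : W1Phi h) : (u + v).grad =ᵐ[vol Ω] u.grad + v.grad :=
  AEEqFun.coeFn_add _ _

lemma fn_smul (r : ℝ) (u : W1Phi h) : (r • u).fn =ᵐ[vol Ω] r • u.fn := AEEqFun.coeFn_smul _ _

lemma grad_smul (r : ℝ) (u : W1Phi h) : (r • u).grad =ᵐ[vol Ω] r • u.grad :=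
  AEEqFun.coeFn_smul _ _

lemma fn_zero : (0 : W1Phi h).fn =ᵐ[vol Ω] 0 := AEEqFun.coeFn_zero

lemma grad_zero : (0 : W1Phi h).grad =ᵐ[vol Ω] 0 := AEEqFun.coeFn_zero

/-- `∫_Ω [Φ(x,|u(x)|/μ) + Φ(x,|∇u(x)|/μ)] dx ∈ [0,∞]`. -/
def scaledModular (u : W1Phi h) (μ : ℝ) : ENNReal :=
  ∫⁻ x, ENNReal.ofReal (bigPhi a x (|u.fn x| / μ) + bigPhi a x (‖u.grad x‖ / μ)) ∂(vol Ω)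

/-- The numbers over which the infimum in the definition of the norm is taken. -/
def normSet (u : W1Phi h) : Set ℝ := {μ : ℝ | 0 < μ ∧ u.scaledModular μ ≤ 1}

/-- The Luxemburg type norm
`‖u‖ = inf {μ > 0 : ∫_Ω [Φ(x,|u(x)|/μ) + Φ(x,|∇u(x)|/μ)] dx ≤ 1}`. -/
instance : Norm (W1Phi h) := ⟨fun u => sInf u.normSet⟩

lemma norm_def (u : W1Phi h) : ‖u‖ = sInf u.normSet := rfl

lemma normSet_bddBelow (u : W1Phi h) : BddBelow u.normSet := ⟨0, fun _ hμ => hμ.1.le⟩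

lemma normSet_nonempty (u : W1Phi h) : u.normSet.Nonempty := by
  have e1 := u.memLPhi_fn.2.eventually (Iic_mem_nhds (show (0 : ENNReal) < 2⁻¹ by simp))
  have e2 := u.memLPhi_grad.2.eventually (Iic_mem_nhds (show (0 : ENNReal) < 2⁻¹ by simp))
  obtain ⟨c, ⟨hc1, hc2⟩, hc⟩ := ((e1.and e2).and self_mem_nhdsWithin).exists
  have hc : 0 < c := hc
  refine ⟨c⁻¹, inv_pos.2 hc, ?_⟩
  have hs : u.scaledModular c⁻¹ = modular Ω a (fun x => c • u.fn x)
      + modular Ω a (fun x => c • u.grad x) := by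
    simp only [modular]
    rw [← lintegral_add_left' (modular_aemeasurable h
      (f := fun x => c • u.fn x) (u.memLPhi_fn.1.const_smul c))]
    refine lintegral_congr_ae ?_
    filter_upwards [ae_mem Ω] with x hx
    have e3 : |u.fn x| / c⁻¹ = ‖c • u.fn x‖ := by
      rw [norm_smul, Real.norm_eq_abs, Real.norm_eq_abs, abs_of_pos hc, div_inv_eq_mul, mul_comm]
    have e4 : ‖u.grad x‖ / c⁻¹ = ‖c • u.grad x‖ := by
      rw [norm_smul, Real.norm_eq_abs, abs_of_pos hc, div_inv_eq_mul, mul_comm]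
    rw [e3, e4, ENNReal.ofReal_add (h.nonneg hx (norm_nonneg _)) (h.nonneg hx (norm_nonneg _))]
  rw [hs, ← ENNReal.inv_two_add_inv_two]
  exact add_le_add hc1 hc2

lemma norm_nonneg' (u : W1Phi h) : 0 ≤ ‖u‖ := Real.sInf_nonneg fun _ hμ => hμ.1.le

lemma norm_zero' : ‖(0 : W1Phi h)‖ = 0 := by
  have : (0 : W1Phi h).normSet = Set.Ioi 0 := by
    ext μ
    refine ⟨fun hμ => hμ.1, fun hμ => ⟨hμ, ?_⟩⟩
    have : (0 : W1Phi h).scaledModular μ = 0 := by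
      rw [scaledModular, ← lintegral_zero (μ := vol Ω)]
      refine lintegral_congr_ae ?_
      filter_upwards [fn_zero (h := h), grad_zero (h := h)] with x h1 h2
      simp [h1, h2, bigPhi_zero]
    rw [this]
    exact zero_le
  rw [norm_def, this, csInf_Ioi]

lemma scaledModular_smul {r : ℝ} (hr : r ≠ 0) (u : W1Phi h) (μ : ℝ) :
    (r • u).scaledModular (|r| * μ) = u.scaledModular μ := by
  refine lintegral_congr_ae ?_
  have hr' : |r| ≠ 0 := abs_ne_zero.2 hr
  filter_upwards [fn_smul r u, grad_smul r u] with x h1 h2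
  rw [h1, h2, Pi.smul_apply, Pi.smul_apply, norm_smul, smul_eq_mul, abs_mul, Real.norm_eq_abs,
    mul_div_mul_left _ _ hr', mul_div_mul_left _ _ hr']

lemma norm_smul' (r : ℝ) (u : W1Phi h) : ‖r • u‖ = ‖r‖ * ‖u‖ := by
  by_cases hr : r = 0
  · subst hr
    rw [zero_smul, norm_zero', norm_zero, zero_mul]
  have hpos : 0 < |r| := abs_pos.2 hr
  have hset : (r • u).normSet = (fun μ => |r| * μ) '' u.normSet := by
    ext μ
    constructor
    · rintro ⟨h1, h2⟩
      refine ⟨μ / |r|, ⟨div_pos h1 hpos, ?_⟩, mul_div_cancel₀ _ hpos.ne'⟩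
      rwa [← scaledModular_smul hr, mul_div_cancel₀ _ hpos.ne']
    · rintro ⟨ν, ⟨h1, h2⟩, rfl⟩
      exact ⟨mul_pos hpos h1, by rwa [scaledModular_smul hr]⟩
  rw [norm_def, norm_def, hset, Real.norm_eq_abs]
  exact Real.sInf_smul_of_nonneg hpos.le u.normSet

lemma bigPhi_combine (h : IsAdmissible Ω a) {x : Vec N} (hx : x ∈ Ω) {s t w μ ν : ℝ}
    (hw : 0 ≤ w) (hwst : w ≤ s + t) (hμ : 0 < μ) (hν : 0 < ν) :
    bigPhi a x (w / (μ + ν)) ≤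
      μ / (μ + ν) * bigPhi a x (s / μ) + ν / (μ + ν) * bigPhi a x (t / ν) := by
  have hp : 0 < μ + ν := add_pos hμ hν
  have e : (s + t) / (μ + ν) = (μ / (μ + ν)) • (s / μ) + (ν / (μ + ν)) • (t / ν) := by
    simp only [smul_eq_mul]; field_simp
  refine (h.mono hx (div_nonneg hw hp.le) (div_le_div_of_nonneg_right hwst hp.le)).trans ?_
  rw [e]
  exact (h.convexOn hx).2 (Set.mem_univ _) (Set.mem_univ _) (by positivity) (by positivity)
    (by field_simp)

lemma scaledModular_aemeasurable (u : W1Phi h) {μ : ℝ} (hμ : 0 < μ) :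
    AEMeasurable (fun x => ENNReal.ofReal
      (bigPhi a x (|u.fn x| / μ) + bigPhi a x (‖u.grad x‖ / μ))) (vol Ω) := by
  refine ((h.aemeasurable_comp ?_ fun x => ?_).add
    (h.aemeasurable_comp ?_ fun x => ?_)).ennreal_ofReal
  · exact u.memLPhi_fn.1.norm.aemeasurable.div_const μ
  · positivity
  · exact u.memLPhi_grad.1.norm.aemeasurable.div_const μ
  · positivity

lemma add_mem_normSet {u v : W1Phi h} {μ ν : ℝ} (hμ : μ ∈ u.normSet) (hν : ν ∈ v.normSet) :
    μ + ν ∈ (u + v).normSet := by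
  obtain ⟨hμ0, hμ1⟩ := hμ
  obtain ⟨hν0, hν1⟩ := hν
  have hp : 0 < μ + ν := add_pos hμ0 hν0
  refine ⟨hp, ?_⟩
  have hα : 0 ≤ μ / (μ + ν) := by positivity
  have hβ : 0 ≤ ν / (μ + ν) := by positivity
  calc (u + v).scaledModular (μ + ν)
      ≤ ∫⁻ x, (ENNReal.ofReal (μ / (μ + ν)) * ENNReal.ofReal
            (bigPhi a x (|u.fn x| / μ) + bigPhi a x (‖u.grad x‖ / μ))
          + ENNReal.ofReal (ν / (μ + ν)) * ENNReal.ofReal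
            (bigPhi a x (|v.fn x| / ν) + bigPhi a x (‖v.grad x‖ / ν))) ∂(vol Ω) := by
        refine lintegral_mono_ae ?_
        filter_upwards [ae_mem Ω, fn_add u v, grad_add u v] with x hx h1 h2
        have n1 : 0 ≤ bigPhi a x (|u.fn x| / μ) := h.nonneg hx (by positivity)
        have n2 : 0 ≤ bigPhi a x (‖u.grad x‖ / μ) := h.nonneg hx (by positivity)
        have n3 : 0 ≤ bigPhi a x (|v.fn x| / ν) := h.nonneg hx (by positivity)
        have n4 : 0 ≤ bigPhi a x (‖v.grad x‖ / ν) := h.nonneg hx (by positivity)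
        rw [← ENNReal.ofReal_mul hα, ← ENNReal.ofReal_mul hβ,
          ← ENNReal.ofReal_add (by positivity) (by positivity)]
        refine ENNReal.ofReal_le_ofReal ?_
        rw [h1, h2]
        have c1 := bigPhi_combine h hx (abs_nonneg ((u.fn + v.fn) x))
          (abs_add_le (u.fn x) (v.fn x)) hμ0 hν0
        have c2 := bigPhi_combine h hx (norm_nonneg ((u.grad + v.grad) x))
          (norm_add_le (u.grad x) (v.grad x)) hμ0 hν0
        linarith
    _ = ENNReal.ofReal (μ / (μ + ν)) * u.scaledModular μ
          + ENNReal.ofReal (ν / (μ + ν)) * v.scaledModular ν := by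
        rw [lintegral_add_left' ((u.scaledModular_aemeasurable hμ0).const_mul _),
          lintegral_const_mul' _ _ ENNReal.ofReal_ne_top,
          lintegral_const_mul' _ _ ENNReal.ofReal_ne_top]
        rfl
    _ ≤ ENNReal.ofReal (μ / (μ + ν)) * 1 + ENNReal.ofReal (ν / (μ + ν)) * 1 := by gcongr
    _ = 1 := by
        rw [mul_one, mul_one, ← ENNReal.ofReal_add hα hβ, ← add_div, div_self hp.ne',
          ENNReal.ofReal_one]

lemma norm_add_le' (u v : W1Phi h) : ‖u + v‖ ≤ ‖u‖ + ‖v‖ := by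
  rw [norm_def, norm_def, norm_def, ← csInf_add u.normSet_nonempty u.normSet_bddBelow
    v.normSet_nonempty v.normSet_bddBelow]
  refine csInf_le_csInf (normSet_bddBelow _) (u.normSet_nonempty.add v.normSet_nonempty) ?_
  rintro _ ⟨μ, hμ, ν, hν, rfl⟩
  exact add_mem_normSet hμ hν

lemma scaledModular_one_le (u : W1Phi h) {μ : ℝ} (hμ : μ ∈ u.normSet) (hμ1 : μ ≤ 1) :
    u.scaledModular 1 ≤ ENNReal.ofReal μ := by
  obtain ⟨hμ0, hm⟩ := hμ
  have aux : ∀ x ∈ Ω, ∀ s : ℝ, bigPhi a x (s / 1) ≤ μ * bigPhi a x (s / μ) := by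
    intro x hx s
    have c := (h.convexOn hx).2 (Set.mem_univ (s / μ)) (Set.mem_univ 0) hμ0.le
      (sub_nonneg.2 hμ1) (by ring)
    simp only [smul_eq_mul, mul_zero, add_zero, bigPhi_zero, mul_div_cancel₀ s hμ0.ne'] at c
    rwa [div_one]
  calc u.scaledModular 1
      ≤ ∫⁻ x, ENNReal.ofReal μ * ENNReal.ofReal
          (bigPhi a x (|u.fn x| / μ) + bigPhi a x (‖u.grad x‖ / μ)) ∂(vol Ω) := by
        refine lintegral_mono_ae ?_
        filter_upwards [ae_mem Ω] with x hx
        rw [← ENNReal.ofReal_mul hμ0.le, mul_add]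
        exact ENNReal.ofReal_le_ofReal (add_le_add (aux x hx _) (aux x hx _))
    _ = ENNReal.ofReal μ * u.scaledModular μ := lintegral_const_mul' _ _ ENNReal.ofReal_ne_top
    _ ≤ ENNReal.ofReal μ * 1 := by gcongr
    _ = ENNReal.ofReal μ := mul_one _

lemma eq_zero_of_norm (u : W1Phi h) (hu : ‖u‖ = 0) : u = 0 := by
  have hz : u.scaledModular 1 = 0 := by
    refine le_antisymm (ENNReal.le_of_forall_pos_le_add fun ε hε _ => ?_) zero_le
    rw [zero_add]
    have hlt : sInf u.normSet < min (ε : ℝ) 1 := by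
      rw [← norm_def, hu]
      exact lt_min (by exact_mod_cast hε) one_pos
    obtain ⟨μ, hμ, hμε⟩ := exists_lt_of_csInf_lt u.normSet_nonempty hlt
    refine (u.scaledModular_one_le hμ (hμε.le.trans (min_le_right _ _))).trans ?_
    rw [← ENNReal.ofReal_coe_nnreal]
    exact ENNReal.ofReal_le_ofReal (hμε.le.trans (min_le_left _ _))
  have hae := (lintegral_eq_zero_iff' (u.scaledModular_aemeasurable one_pos)).1 hz
  have hboth : ∀ᵐ x ∂(vol Ω), u.fn x = 0 ∧ u.grad x = 0 := by
    filter_upwards [hae, ae_mem Ω] with x h0 hx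
    have n1 : 0 ≤ bigPhi a x (|u.fn x| / 1) := h.nonneg hx (by positivity)
    have n2 : 0 ≤ bigPhi a x (‖u.grad x‖ / 1) := h.nonneg hx (by positivity)
    have h0' := ENNReal.ofReal_eq_zero.1 h0
    have e1 := h.eq_zero hx (by positivity) (le_antisymm (by linarith) n1)
    have e2 := h.eq_zero hx (by positivity) (le_antisymm (by linarith) n2)
    rw [div_one] at e1 e2
    exact ⟨abs_eq_zero.1 e1, norm_eq_zero.1 e2⟩
  refine Subtype.ext (Prod.ext (AEEqFun.ext ?_) (AEEqFun.ext ?_))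
  · filter_upwards [hboth, fn_zero (h := h)] with x hx h0
    exact hx.1.trans h0.symm
  · filter_upwards [hboth, grad_zero (h := h)] with x hx h0
    exact hx.2.trans h0.symm

lemma normCore (h : IsAdmissible Ω a) : NormedSpace.Core ℝ (W1Phi h) where
  norm_nonneg := norm_nonneg'
  norm_smul := norm_smul'
  norm_triangle := norm_add_le'
  norm_eq_zero_iff u := ⟨u.eq_zero_of_norm, fun hu => by rw [hu, norm_zero']⟩

instance : NormedAddCommGroup (W1Phi h) := NormedAddCommGroup.ofCore (normCore h)

instance : NormedSpace ℝ (W1Phi h) := NormedSpace.ofCore (normCore h)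

/-- The functional `Λ(u) = ∫_Ω [Φ(x,|∇u(x)|) + Φ(x,|u(x)|)] dx` on `W^{1,Φ}(Ω)`. -/
def Lambda (u : W1Phi h) : ℝ :=
  ∫ x, (bigPhi a x ‖u.grad x‖ + bigPhi a x |u.fn x|) ∂(vol Ω)

end W1Phi

end OrliczSobolev

end

/-! The functional `Λ` is convex and uniformly convex enough to control `u n - v` directly.
Convexity of `t ↦ Φ(x,√t)` with value 0 at 0 makes this function superadditive; combined with the
parallelogram law it gives a Clarkson inequality, which integrates to `Λ((p+q)/2) + Λ((p-q)/2) ≤ (Λ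
p + Λ q)/2` (`Lambda_clarkson`). Take `p = u n`, `q = v`. The gradient inequality at `u n` and the
limsup hypothesis bound `Λ (u n)` by `Λ v` up to a small error. The gradient inequality at `v` and
weak convergence, tested only on the functional `Λ'(v)`, bound `Λ((u n + v)/2)` below by `Λ v` up to
a small error. Hence `Λ((u n - v)/2) → 0`, and the doubling condition turns this modular convergence
into norm convergence (`tendsto_zero_of_Lambda`).

The gradient inequalities require `Λ` to be differentiable, and most of the work is that fact
(`hasFDerivAt_Lambda`). It is obtained without conjugate functions or Hölder's inequality:
convexity, doubling and the quadratic bound `Φ(x,ct) ≤ c²Φ(x,t)` for `c ≤ 1` control the first order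
remainder. Up to a small multiple of the modular of the normalised increment, it is dominated by a
fixed integrable function, and dominated convergence applies. -/

noncomputable section

namespace OrliczSobolev

variable {N : ℕ}

/-! ### Convexity inequalities in real vector spaces. -/

/-- The gradient inequality for a convex function that is differentiable at `z`. -/
lemma convex_fderiv_le {E : Type*} [NormedAddCommGroup E] [NormedSpace ℝ E] {f : E → ℝ}
    (hf : ConvexOn ℝ Set.univ f) {z : E} (hd : DifferentiableAt ℝ f z) (w : E) :
    fderiv ℝ f z w ≤ f (z + w) - f z := by
  have hline : HasDerivAt (fun t : ℝ => z + t • w) w 0 := by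
    simpa using ((hasDerivAt_id (0 : ℝ)).smul_const w).const_add z
  have hz : HasFDerivAt f (fderiv ℝ f z) (z + (0 : ℝ) • w) := by simpa using hd.hasFDerivAt
  have hcomp := hz.comp_hasDerivAt (0 : ℝ) hline
  have hconv : ConvexOn ℝ Set.univ (f ∘ fun t : ℝ => z + t • w) := by
    refine ⟨convex_univ, fun s _ t _ α β hα hβ hαβ => ?_⟩
    have e : z + (α • s + β • t) • w = α • (z + s • w) + β • (z + t • w) := by
      rw [add_smul, smul_add, smul_add, smul_assoc, smul_assoc,
        show α • z + α • s • w + (β • z + β • t • w) = (α • z + β • z) + (α • s • w + β • t • w) by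
          abel, ← add_smul, hαβ, one_smul]
    simp only [Function.comp, e]
    exact hf.2 (Set.mem_univ _) (Set.mem_univ _) hα hβ hαβ
  have := hconv.le_slope_of_hasDerivAt (Set.mem_univ 0) (Set.mem_univ 1) one_pos hcomp
  simpa [slope] using this

/-- Difference quotients of a convex function are monotone in the increment. -/
lemma convex_quotient_le {E : Type*} [AddCommGroup E] [Module ℝ E] {f : E → ℝ}
    (hf : ConvexOn ℝ Set.univ f) (z w : E) {s r : ℝ} (hs : 0 < s) (hsr : s ≤ r) :
    (f (z + s • w) - f z) / s ≤ (f (z + r • w) - f z) / r := by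
  have hr : 0 < r := hs.trans_le hsr
  have e : z + s • w = (1 - s / r) • z + (s / r) • (z + r • w) := by
    rw [smul_add, smul_smul, div_mul_cancel₀ _ hr.ne', sub_smul, one_smul]
    abel
  have c := hf.2 (Set.mem_univ z) (Set.mem_univ (z + r • w))
    (sub_nonneg.2 ((div_le_one hr).2 hsr)) (div_nonneg hs.le hr.le) (by ring)
  rw [← e, smul_eq_mul, smul_eq_mul] at c
  rw [div_le_iff₀ hs]
  calc f (z + s • w) - f z ≤ s / r * (f (z + r • w) - f z) := by linarith
    _ = _ := by ring

/-- A convex function is bounded on midpoints by half the sum of its values at the doubled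
points. -/
lemma convex_add_le {E : Type*} [AddCommGroup E] [Module ℝ E] {f : E → ℝ}
    (hf : ConvexOn ℝ Set.univ f) (z w : E) :
    f (z + w) ≤ (f ((2 : ℝ) • z) + f ((2 : ℝ) • w)) / 2 := by
  have c := hf.2 (Set.mem_univ ((2 : ℝ) • z)) (Set.mem_univ ((2 : ℝ) • w))
    (show (0 : ℝ) ≤ 1 / 2 by norm_num) (show (0 : ℝ) ≤ 1 / 2 by norm_num) (by norm_num)
  rw [smul_smul, smul_smul] at c
  norm_num at c
  linarith

/-! ### Growth, convexity and smoothness of `Φ(x,·)` at a fixed point. -/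

section Pointwise

variable {Ω : TopologicalSpace.Opens (Vec N)} {a : Vec N → ℝ → ℝ}

/-- The upper growth bound `sφ ≤ pΦ` says `(log Φ)' ≤ p/s ≤ p/t` on `[t, 2t]`, so `Φ(x,s)
exp(-(p/t)s)` is nonincreasing there. Comparing the endpoints gives the constant `exp p`, which does
not depend on `x`. -/
lemma IsAdmissible.exists_doubling (h : IsAdmissible Ω a) :
    ∃ C : ℝ, 0 < C ∧ ∀ x ∈ Ω, ∀ t : ℝ, 0 ≤ t → bigPhi a x (2 * t) ≤ C * bigPhi a x t := by
  obtain ⟨q, p, hq, hp⟩ := h.growth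
  refine ⟨Real.exp p, Real.exp_pos p, fun x hx t ht => ?_⟩
  rcases ht.eq_or_lt with rfl | ht
  · simp [bigPhi_zero]
  have hp0 : 0 ≤ p := by linarith [(hp x hx t ht).1, (hp x hx t ht).2]
  have hd : ∀ s : ℝ, HasDerivAt (fun s => bigPhi a x s * Real.exp (-(p / t) * s))
      (phi a x s * Real.exp (-(p / t) * s)
        + bigPhi a x s * (Real.exp (-(p / t) * s) * -(p / t))) s := fun s => by
    have h1 : HasDerivAt (fun s : ℝ => -(p / t) * s) (-(p / t)) s := by
      simpa using (hasDerivAt_id s).const_mul (-(p / t))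
    exact (h.hasDerivAt hx s).mul h1.exp
  have hanti : AntitoneOn (fun s => bigPhi a x s * Real.exp (-(p / t) * s))
      (Set.Icc t (2 * t)) := by
    refine antitoneOn_of_deriv_nonpos (convex_Icc _ _)
      (fun s _ => (hd s).continuousAt.continuousWithinAt)
      (fun s _ => (hd s).differentiableAt.differentiableWithinAt) fun s hs => ?_
    rw [interior_Icc] at hs
    have hs0 : 0 < s := ht.trans hs.1
    have hpos : 0 < bigPhi a x s :=
      lt_of_le_of_ne (h.nonneg hx hs0.le) fun e => hs0.ne' (h.eq_zero hx hs0.le e.symm)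
    have h1 := (div_le_iff₀ hpos).1 (hp x hx s hs0).2
    have h2 : phi a x s ≤ p / t * bigPhi a x s := by
      have h3 : phi a x s ≤ p * bigPhi a x s / s := by
        rw [le_div_iff₀ hs0]; linarith
      refine h3.trans ?_
      rw [div_mul_eq_mul_div]
      exact div_le_div_of_nonneg_left (mul_nonneg hp0 hpos.le) ht hs.1.le
    rw [(hd s).deriv]
    have := mul_nonneg (sub_nonneg.2 h2) (Real.exp_pos (-(p / t) * s)).le
    linarith
  have hle := hanti (Set.left_mem_Icc.2 (by linarith)) (Set.right_mem_Icc.2 (by linarith))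
    (show t ≤ 2 * t by linarith)
  have e1 : -(p / t) * t = -p := by field_simp
  have e2 : -(p / t) * (2 * t) = -p + -p := by field_simp; ring
  simp only [e1, e2, Real.exp_add, ← mul_assoc] at hle
  have h4 := le_of_mul_le_mul_right hle (Real.exp_pos (-p))
  rwa [Real.exp_neg, ← div_eq_mul_inv, div_le_iff₀ (Real.exp_pos p),
    mul_comm _ (Real.exp p)] at h4

/-- Convexity of `Φ(x,√·)` makes `Φ(x,·)` at least quadratic. -/
lemma IsAdmissible.mul_le_sq (h : IsAdmissible Ω a) {x : Vec N} (hx : x ∈ Ω) {c t : ℝ}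
    (hc : 0 ≤ c) (hc1 : c ≤ 1) (ht : 0 ≤ t) : bigPhi a x (c * t) ≤ c ^ 2 * bigPhi a x t := by
  have hcc : c ^ 2 ≤ 1 := pow_le_one₀ hc hc1
  have k := (h.convex_sqrt x hx).2 (Set.mem_Ici.2 (sq_nonneg t)) (Set.mem_Ici.2 le_rfl)
    (sq_nonneg c) (sub_nonneg.2 hcc) (by ring)
  simp only [smul_eq_mul, mul_zero, add_zero, Real.sqrt_zero, bigPhi_zero] at k
  rwa [← mul_pow, Real.sqrt_sq (mul_nonneg hc ht), Real.sqrt_sq ht] at k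

/-- A Clarkson type inequality. -/
lemma IsAdmissible.clarkson (h : IsAdmissible Ω a) {x : Vec N} (hx : x ∈ Ω)
    {V : Type*} [NormedAddCommGroup V] [InnerProductSpace ℝ V] (z w : V) :
    bigPhi a x ‖z + w‖ + bigPhi a x ‖z - w‖
      ≤ (bigPhi a x ‖(2 : ℝ) • z‖ + bigPhi a x ‖(2 : ℝ) • w‖) / 2 := by
  set Q : ℝ → ℝ := fun t => bigPhi a x √t with hQ
  have hc : ConvexOn ℝ (Set.Ici 0) Q := h.convex_sqrt x hx
  have hQ0 : Q 0 = 0 := by simp [hQ, bigPhi_zero]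
  have hQn : ∀ v : V, bigPhi a x ‖v‖ = Q (‖v‖ ^ 2) := fun v => by
    simp only [hQ, Real.sqrt_sq (norm_nonneg v)]
  -- A convex function on the half line vanishing at 0 is superadditive: each of `Q p`, `Q q` lies
  -- below the chord from 0 to `p + q`.
  have hsup : ∀ p q : ℝ, 0 ≤ p → 0 ≤ q → Q p + Q q ≤ Q (p + q) := by
    intro p q hp hq
    rcases (add_nonneg hp hq).eq_or_lt with e | e
    · obtain rfl : p = 0 := by linarith
      obtain rfl : q = 0 := by linarith
      simp [hQ0]
    have aux : ∀ r : ℝ, 0 ≤ r → r ≤ p + q → Q r ≤ r / (p + q) * Q (p + q) := by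
      intro r hr hrp
      have k := hc.2 (Set.mem_Ici.2 e.le) (Set.mem_Ici.2 le_rfl) (div_nonneg hr e.le)
        (sub_nonneg.2 ((div_le_one e).2 hrp)) (by ring)
      simpa only [smul_eq_mul, mul_zero, add_zero, hQ0, div_mul_cancel₀ r e.ne'] using k
    have h1 := aux p hp (by linarith)
    have h2 := aux q hq (by linarith)
    have h3 : p / (p + q) * Q (p + q) + q / (p + q) * Q (p + q) = Q (p + q) := by
      rw [← add_mul, ← add_div, div_self e.ne', one_mul]
    linarith
  rw [hQn, hQn, hQn, hQn]
  refine (hsup _ _ (sq_nonneg _) (sq_nonneg _)).trans ?_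
  -- The parallelogram law, written so that the right side is a midpoint to which convexity of `Q`
  -- applies.
  have e : ‖z + w‖ ^ 2 + ‖z - w‖ ^ 2
      = (1 / 2 : ℝ) • ‖(2 : ℝ) • z‖ ^ 2 + (1 / 2 : ℝ) • ‖(2 : ℝ) • w‖ ^ 2 := by
    have := parallelogram_law_with_norm ℝ z w
    simp only [norm_smul, smul_eq_mul, Real.norm_ofNat]
    nlinarith
  rw [e]
  have k := hc.2 (Set.mem_Ici.2 (sq_nonneg ‖(2 : ℝ) • z‖)) (Set.mem_Ici.2 (sq_nonneg ‖(2 : ℝ) • w‖))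
    (show (0 : ℝ) ≤ 1 / 2 by norm_num) (show (0 : ℝ) ≤ 1 / 2 by norm_num) (by norm_num)
  simp only [smul_eq_mul] at k ⊢
  linarith

lemma IsAdmissible.convexOn_norm (h : IsAdmissible Ω a) {x : Vec N} (hx : x ∈ Ω)
    {V : Type*} [NormedAddCommGroup V] [NormedSpace ℝ V] :
    ConvexOn ℝ Set.univ (fun z : V => bigPhi a x ‖z‖) := by
  refine ⟨convex_univ, fun z _ w _ α β hα hβ hαβ => ?_⟩
  refine (h.mono hx (norm_nonneg _) (norm_add_le _ _)).trans ?_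
  rw [norm_smul, norm_smul, Real.norm_of_nonneg hα, Real.norm_of_nonneg hβ]
  exact (h.convexOn hx).2 (Set.mem_univ _) (Set.mem_univ _) hα hβ hαβ

/-- Away from 0 the Hilbert norm is differentiable. At 0, where it is not, `φ(x,0) = 0` gives
`Φ(x,t) = o(t)`, so the derivative exists and vanishes. -/
lemma IsAdmissible.differentiable_norm (h : IsAdmissible Ω a) {x : Vec N} (hx : x ∈ Ω)
    {V : Type*} [NormedAddCommGroup V] [InnerProductSpace ℝ V] :
    Differentiable ℝ (fun z : V => bigPhi a x ‖z‖) := by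
  intro z
  by_cases hz : z = 0
  · subst hz
    have : HasFDerivAt (fun z : V => bigPhi a x ‖z‖) (0 : V →L[ℝ] ℝ) 0 := by
      have hder : HasDerivAt (bigPhi a x) 0 0 := by
        simpa [phi_zero] using h.hasDerivAt hx 0
      rw [hasDerivAt_iff_isLittleO] at hder
      rw [hasFDerivAt_iff_isLittleO]
      have ht : Tendsto (fun z : V => ‖z‖) (𝓝 0) (𝓝 0) := by
        simpa using (continuous_norm (E := V)).tendsto 0
      have := (hder.comp_tendsto ht).norm_norm
      refine Asymptotics.IsLittleO.of_norm_right ?_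
      simpa [Function.comp_def, bigPhi_zero, Asymptotics.isLittleO_norm_left] using this
    exact this.differentiableAt
  · exact (h.hasDerivAt hx ‖z‖).differentiableAt.comp z
      (differentiableAt_id.norm ℝ hz)

/-! ### The combined integrand for a function and its gradient. -/

/-- The integrand `Φ(x,|s|) + Φ(x,|z|)` of the modular of `W^{1,Φ}(Ω)`. -/
def density (a : Vec N → ℝ → ℝ) (x : Vec N) (p : ℝ × Vec N) : ℝ :=
  bigPhi a x ‖p.1‖ + bigPhi a x ‖p.2‖

lemma density_neg (x : Vec N) (p : ℝ × Vec N) : density a x (-p) = density a x p := by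
  simp [density]

lemma density_zero (x : Vec N) : density a x 0 = 0 := by
  simp [density, bigPhi_zero]

lemma IsAdmissible.density_nonneg (h : IsAdmissible Ω a) {x : Vec N} (hx : x ∈ Ω)
    (p : ℝ × Vec N) : 0 ≤ density a x p :=
  add_nonneg (h.nonneg hx (norm_nonneg _)) (h.nonneg hx (norm_nonneg _))

lemma IsAdmissible.density_convexOn (h : IsAdmissible Ω a) {x : Vec N} (hx : x ∈ Ω) :
    ConvexOn ℝ Set.univ (density a x) :=
  ((h.convexOn_norm hx (V := ℝ)).comp_linearMap (LinearMap.fst ℝ ℝ (Vec N))).add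
    ((h.convexOn_norm hx (V := Vec N)).comp_linearMap (LinearMap.snd ℝ ℝ (Vec N)))

lemma IsAdmissible.density_differentiable (h : IsAdmissible Ω a) {x : Vec N} (hx : x ∈ Ω) :
    Differentiable ℝ (density a x) :=
  ((h.differentiable_norm hx (V := ℝ)).comp differentiable_fst).add
    ((h.differentiable_norm hx (V := Vec N)).comp differentiable_snd)

lemma IsAdmissible.density_clarkson (h : IsAdmissible Ω a) {x : Vec N} (hx : x ∈ Ω)
    (p q : ℝ × Vec N) : density a x (p + q) + density a x (p - q)
      ≤ (density a x ((2 : ℝ) • p) + density a x ((2 : ℝ) • q)) / 2 := by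
  have h1 := h.clarkson hx p.1 q.1
  have h2 := h.clarkson hx p.2 q.2
  simp only [density, Prod.fst_add, Prod.snd_add, Prod.fst_sub, Prod.snd_sub, Prod.smul_fst,
    Prod.smul_snd]
  linarith

lemma IsAdmissible.density_smul_le_sq (h : IsAdmissible Ω a) {x : Vec N} (hx : x ∈ Ω) {c : ℝ}
    (hc : 0 ≤ c) (hc1 : c ≤ 1) (p : ℝ × Vec N) :
    density a x (c • p) ≤ c ^ 2 * density a x p := by
  have h1 := h.mul_le_sq hx hc hc1 (norm_nonneg p.1)
  have h2 := h.mul_le_sq hx hc hc1 (norm_nonneg p.2)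
  simp only [density, Prod.smul_fst, Prod.smul_snd, norm_smul, Real.norm_of_nonneg hc] at h1 h2 ⊢
  linarith

lemma IsAdmissible.exists_density_doubling (h : IsAdmissible Ω a) :
    ∃ C : ℝ, 0 < C ∧ ∀ x ∈ Ω, ∀ p, density a x ((2 : ℝ) • p) ≤ C * density a x p := by
  obtain ⟨C, hC, hd⟩ := h.exists_doubling
  refine ⟨C, hC, fun x hx p => ?_⟩
  have h1 := hd x hx _ (norm_nonneg p.1)
  have h2 := hd x hx _ (norm_nonneg p.2)
  simp only [density, Prod.smul_fst, Prod.smul_snd, norm_smul, Real.norm_ofNat] at h1 h2 ⊢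
  linarith

lemma IsAdmissible.exists_density_scaling (h : IsAdmissible Ω a) (r : ℝ) :
    ∃ C : ℝ, 0 < C ∧ ∀ x ∈ Ω, ∀ p, density a x (r • p) ≤ C * density a x p := by
  obtain ⟨C, hC, hd⟩ := h.exists_density_doubling
  have hpow : ∀ m : ℕ, ∀ x ∈ Ω, ∀ p, density a x ((2 : ℝ) ^ m • p) ≤ C ^ m * density a x p := by
    intro m x hx
    induction m with
    | zero => simp
    | succ m ih =>
      intro p
      rw [pow_succ, mul_smul, pow_succ, mul_assoc]
      exact (ih _).trans (mul_le_mul_of_nonneg_left (hd x hx p) (by positivity))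
  obtain ⟨m, hm⟩ := pow_unbounded_of_one_lt |r| one_lt_two
  refine ⟨C ^ m, pow_pos hC m, fun x hx p => le_trans ?_ (hpow m x hx p)⟩
  have aux : ∀ {V : Type} [NormedAddCommGroup V] [NormedSpace ℝ V] (v : V),
      ‖r • v‖ ≤ ‖(2 : ℝ) ^ m • v‖ := fun v => by
    rw [norm_smul, norm_smul, Real.norm_eq_abs, Real.norm_of_nonneg (by positivity)]
    exact mul_le_mul_of_nonneg_right hm.le (norm_nonneg v)
  exact add_le_add (h.mono hx (norm_nonneg _) (aux _)) (h.mono hx (norm_nonneg _) (aux _))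

/-- At least quadratic growth makes sublevel sets bounded; `M` may depend on `x`, since it serves
only in a pointwise limit. -/
lemma IsAdmissible.density_coercive (h : IsAdmissible Ω a) {x : Vec N} (hx : x ∈ Ω) (B : ℝ) :
    ∃ M : ℝ, 0 < M ∧ ∀ p, density a x p < B → ‖p‖ ≤ M := by
  have h1 : 0 < bigPhi a x 1 :=
    lt_of_le_of_ne (h.nonneg hx zero_le_one) fun e => one_ne_zero (h.eq_zero hx zero_le_one e.symm)
  have key : ∀ t : ℝ, 0 ≤ t → bigPhi a x t < B → t ≤ max 1 (B / bigPhi a x 1) := by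
    intro t ht htB
    by_cases ht1 : t ≤ 1
    · exact le_max_of_le_left ht1
    push Not at ht1
    refine le_max_of_le_right ?_
    -- With factor `1/t` the quadratic bound reads `t² Φ(x,1) ≤ Φ(x,t)`, and `t ≤ t²` for `t > 1`.
    have k := h.mul_le_sq hx (inv_nonneg.2 ht) (inv_le_one_of_one_le₀ ht1.le) ht
    have ht0 : 0 < t := by linarith
    rw [inv_mul_cancel₀ ht0.ne', inv_pow, inv_mul_eq_div, le_div_iff₀ (by positivity)] at k
    rw [le_div_iff₀ h1]
    nlinarith [mul_nonneg (mul_nonneg h1.le ht) (sub_nonneg.2 ht1.le)]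
  refine ⟨max 1 (B / bigPhi a x 1), lt_max_of_lt_left one_pos, fun p hp => ?_⟩
  have n1 := h.nonneg hx (norm_nonneg p.1)
  have n2 := h.nonneg hx (norm_nonneg p.2)
  unfold density at hp
  rw [Prod.norm_def]
  exact max_le (key _ (norm_nonneg _) (by linarith)) (key _ (norm_nonneg _) (by linarith))

/-- The gradient inequality in the directions `w` and `-w` bounds the derivative by values of the
integrand alone, so integrability of the derivative reduces to finiteness of modulars. -/
lemma IsAdmissible.abs_fderiv_density_le (h : IsAdmissible Ω a) {x : Vec N} (hx : x ∈ Ω)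
    (z w : ℝ × Vec N) :
    |fderiv ℝ (density a x) z w| ≤ density a x (z + w) + density a x (z - w) := by
  have h1 := convex_fderiv_le (h.density_convexOn hx) (h.density_differentiable hx z) w
  have h2 := convex_fderiv_le (h.density_convexOn hx) (h.density_differentiable hx z) (-w)
  rw [map_neg, ← sub_eq_add_neg] at h2
  have n0 := h.density_nonneg hx z
  have n1 := h.density_nonneg hx (z + w)
  have n2 := h.density_nonneg hx (z - w)
  exact abs_le.2 ⟨by linarith, by linarith⟩

/-! ### Pointwise control of the first order remainder. -/

/-- The remainder in the first order expansion of the integrand. -/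
def remainder (a : Vec N → ℝ → ℝ) (x : Vec N) (z w : ℝ × Vec N) : ℝ :=
  density a x (z + w) - density a x z - fderiv ℝ (density a x) z w

lemma IsAdmissible.remainder_nonneg (h : IsAdmissible Ω a) {x : Vec N} (hx : x ∈ Ω)
    (z w : ℝ × Vec N) : 0 ≤ remainder a x z w :=
  sub_nonneg.2 (convex_fderiv_le (h.density_convexOn hx) (h.density_differentiable hx z) w)

/-- Monotonicity of difference quotients replaces the step `s` by `r`, and the derivative term is
bounded by the quotient in the direction `-w`. Midpoint convexity then separates `z` from `w`:
doubling handles `2z`, and the quadratic bound turns `2rw` into `(2r)²/r = 4r`. The bound is uniform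
in `s`, and its coefficient at `w` is small with `r`, which is what domination requires. -/
lemma IsAdmissible.remainder_div_le (h : IsAdmissible Ω a) {C : ℝ}
    (hC : ∀ x ∈ Ω, ∀ p, density a x ((2 : ℝ) • p) ≤ C * density a x p)
    {x : Vec N} (hx : x ∈ Ω) (z w : ℝ × Vec N) {s r : ℝ} (hs : 0 < s) (hsr : s ≤ r)
    (hr : r ≤ 1 / 2) :
    remainder a x z (s • w) / s ≤ C / r * density a x z + 4 * r * density a x w := by
  have hr0 : 0 < r := hs.trans_le hsr
  have hcv := h.density_convexOn hx
  have hd := h.density_differentiable hx z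
  have e1 : remainder a x z (s • w) / s
      = (density a x (z + s • w) - density a x z) / s - fderiv ℝ (density a x) z w := by
    rw [remainder, map_smul, smul_eq_mul, sub_div, mul_div_cancel_left₀ _ hs.ne']
  have h1 := convex_quotient_le hcv z w hs hsr
  have h2 := convex_fderiv_le hcv hd (-(r • w))
  rw [map_neg, map_smul, smul_eq_mul, ← sub_eq_add_neg] at h2
  have h3 : -fderiv ℝ (density a x) z w ≤ (density a x (z - r • w) - density a x z) / r := by
    rw [le_div_iff₀ hr0]; linarith
  have h4 := convex_add_le hcv z (r • w)
  have h5 := convex_add_le hcv z (-(r • w))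
  rw [smul_neg, density_neg, ← sub_eq_add_neg] at h5
  have h6 : density a x ((2 : ℝ) • r • w) ≤ (2 * r) ^ 2 * density a x w := by
    rw [smul_smul]
    exact h.density_smul_le_sq hx (by positivity) (by linarith) w
  have h7 := hC x hx z
  have n0 := h.density_nonneg hx z
  have h8 : (density a x (z + r • w) - density a x z) / r
      + (density a x (z - r • w) - density a x z) / r
      ≤ (C * density a x z + (2 * r) ^ 2 * density a x w) / r := by
    rw [← add_div]
    exact div_le_div_of_nonneg_right (by linarith) hr0.le
  have e2 : (C * density a x z + (2 * r) ^ 2 * density a x w) / r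
      = C / r * density a x z + 4 * r * density a x w := by
    field_simp; ring
  linarith

/-- Pointwise, the remainder is of smaller order uniformly in `w` up to a small multiple of the
integrand at `w`. -/
lemma IsAdmissible.exists_remainder_div_le (h : IsAdmissible Ω a) {x : Vec N} (hx : x ∈ Ω)
    (z : ℝ × Vec N) {r : ℝ} (hr0 : 0 < r) (hr : r ≤ 1 / 2) {ε : ℝ} (hε : 0 < ε) :
    ∃ δ > 0, ∀ s : ℝ, 0 < s → s < δ → ∀ w,
      remainder a x z (s • w) / s ≤ ε + 5 * r * density a x w := by
  obtain ⟨C, hC0, hC⟩ := h.exists_density_doubling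
  -- The threshold is chosen so that above it `(C/r) density z ≤ r density w`, which raises the
  -- coefficient `4r` to `5r`. Below it `w` stays in a ball, and differentiability at `z` is uniform
  -- over that ball.
  obtain ⟨M, hM0, hM⟩ := h.density_coercive hx (C / r ^ 2 * density a x z)
  have hd := (h.density_differentiable hx z).hasFDerivAt
  rw [hasFDerivAt_iff_isLittleO_nhds_zero] at hd
  have hev := hd.def (div_pos hε hM0)
  obtain ⟨ρ, hρ, hball⟩ := Metric.eventually_nhds_iff.1 hev
  refine ⟨min r (ρ / M), lt_min hr0 (div_pos hρ hM0), fun s hs hsδ w => ?_⟩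
  by_cases hw : density a x w < C / r ^ 2 * density a x z
  · have hwM := hM w hw
    have hsM : s * M < ρ := (lt_div_iff₀ hM0).1 (hsδ.trans_le (min_le_right _ _))
    have hn : ‖s • w‖ ≤ s * M := by
      rw [norm_smul, Real.norm_of_nonneg hs.le]
      exact mul_le_mul_of_nonneg_left hwM hs.le
    have k := hball (show dist (s • w) 0 < ρ by rw [dist_zero_right]; exact hn.trans_lt hsM)
    have k2 : remainder a x z (s • w) ≤ ε / M * (s * M) :=
      (le_abs_self _).trans (k.trans (mul_le_mul_of_nonneg_left hn (by positivity)))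
    have k3 : remainder a x z (s • w) / s ≤ ε := by
      rw [div_le_iff₀ hs]
      calc _ ≤ _ := k2
        _ = ε * s := by field_simp
    have n := h.density_nonneg hx w
    have : 0 ≤ 5 * r * density a x w := by positivity
    linarith
  · push Not at hw
    have k := h.remainder_div_le hC hx z w hs (hsδ.le.trans (min_le_left _ _)) hr
    have k2 : C / r * density a x z ≤ r * density a x w := by
      calc C / r * density a x z = r * (C / r ^ 2 * density a x z) := by field_simp
        _ ≤ _ := mul_le_mul_of_nonneg_left hw hr0.le
    linarith

end Pointwise

/-! ### Integrability and the modular on the Sobolev space. -/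

namespace W1Phi

variable {Ω : TopologicalSpace.Opens (Vec N)} {a : Vec N → ℝ → ℝ} {h : IsAdmissible Ω a}

/-- The pair `(u(x), ∇u(x))`. -/
def jet (u : W1Phi h) (x : Vec N) : ℝ × Vec N := (u.fn x, u.grad x)

lemma jet_add (u v : W1Phi h) : ∀ᵐ x ∂(vol Ω), (u + v).jet x = u.jet x + v.jet x := by
  filter_upwards [fn_add u v, grad_add u v] with x h1 h2
  exact Prod.ext h1 h2

lemma jet_smul (r : ℝ) (u : W1Phi h) : ∀ᵐ x ∂(vol Ω), (r • u).jet x = r • u.jet x := by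
  filter_upwards [fn_smul r u, grad_smul r u] with x h1 h2
  exact Prod.ext h1 h2

lemma jet_sub (u v : W1Phi h) : ∀ᵐ x ∂(vol Ω), (u - v).jet x = u.jet x - v.jet x := by
  have e : u - v = u + (-1 : ℝ) • v := by rw [neg_one_smul, sub_eq_add_neg]
  rw [e]
  filter_upwards [jet_add u ((-1 : ℝ) • v), jet_smul (-1 : ℝ) v] with x h1 h2
  rw [h1, h2, neg_one_smul, sub_eq_add_neg]

lemma aemeasurable_density_smul (u : W1Phi h) (r : ℝ) :
    AEMeasurable (fun x => density a x (r • u.jet x)) (vol Ω) :=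
  (h.aemeasurable_comp (u.memLPhi_fn.1.const_smul r).norm.aemeasurable
    fun _ => norm_nonneg _).add
  (h.aemeasurable_comp (u.memLPhi_grad.1.const_smul r).norm.aemeasurable fun _ => norm_nonneg _)

lemma aemeasurable_density (u : W1Phi h) :
    AEMeasurable (fun x => density a x (u.jet x)) (vol Ω) := by
  simpa using u.aemeasurable_density_smul 1

lemma scaledModular_eq (u : W1Phi h) {μ : ℝ} (hμ : 0 < μ) :
    u.scaledModular μ = ∫⁻ x, ENNReal.ofReal (density a x (μ⁻¹ • u.jet x)) ∂(vol Ω) := by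
  refine lintegral_congr fun x => ?_
  rw [density, Prod.smul_fst, Prod.smul_snd, norm_smul, norm_smul,
    Real.norm_of_nonneg (inv_nonneg.2 hμ.le), inv_mul_eq_div, inv_mul_eq_div]
  rfl

/-- Membership only makes some rescaled modular finite; the doubling condition removes the scale. -/
lemma integrable_density (u : W1Phi h) :
    Integrable (fun x => density a x (u.jet x)) (vol Ω) := by
  refine ⟨u.aemeasurable_density.aestronglyMeasurable, ?_⟩
  obtain ⟨μ, hμ, hm⟩ := u.normSet_nonempty
  obtain ⟨C, hC, hs⟩ := h.exists_density_scaling μ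
  rw [scaledModular_eq u hμ] at hm
  have key : ∫⁻ x, ‖density a x (u.jet x)‖ₑ ∂(vol Ω)
      ≤ ENNReal.ofReal C * ∫⁻ x, ENNReal.ofReal (density a x (μ⁻¹ • u.jet x)) ∂(vol Ω) := by
    rw [← lintegral_const_mul' _ _ ENNReal.ofReal_ne_top]
    refine lintegral_mono_ae ?_
    filter_upwards [ae_mem Ω] with x hx
    rw [Real.enorm_eq_ofReal (h.density_nonneg hx _), ← ENNReal.ofReal_mul hC.le]
    refine ENNReal.ofReal_le_ofReal ?_
    simpa [smul_smul, mul_inv_cancel₀ hμ.ne'] using hs x hx (μ⁻¹ • u.jet x)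
  exact key.trans_lt (ENNReal.mul_lt_top ENNReal.ofReal_lt_top (hm.trans_lt ENNReal.one_lt_top))

lemma Lambda_eq (u : W1Phi h) : Lambda u = ∫ x, density a x (u.jet x) ∂(vol Ω) :=
  integral_congr_ae (Eventually.of_forall fun _ => add_comm _ _)

lemma Lambda_nonneg (u : W1Phi h) : 0 ≤ Lambda u := by
  rw [Lambda_eq]
  refine integral_nonneg_of_ae ?_
  filter_upwards [ae_mem Ω] with x hx
  exact h.density_nonneg hx _

lemma ofReal_Lambda (u : W1Phi h) :
    ENNReal.ofReal (Lambda u) = ∫⁻ x, ENNReal.ofReal (density a x (u.jet x)) ∂(vol Ω) := by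
  rw [Lambda_eq]
  refine ofReal_integral_eq_lintegral_ofReal u.integrable_density ?_
  filter_upwards [ae_mem Ω] with x hx
  exact h.density_nonneg hx _

lemma scaledModular_eq_ofReal (u : W1Phi h) {μ : ℝ} (hμ : 0 < μ) :
    u.scaledModular μ = ENNReal.ofReal (Lambda (μ⁻¹ • u)) := by
  rw [scaledModular_eq u hμ, ofReal_Lambda]
  refine lintegral_congr_ae ?_
  filter_upwards [jet_smul μ⁻¹ u] with x hx
  rw [hx]

lemma Lambda_le_one {u : W1Phi h} (hu : ‖u‖ < 1) : Lambda u ≤ 1 := by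
  obtain ⟨μ, hμ, hμ1⟩ := exists_lt_of_csInf_lt u.normSet_nonempty hu
  have k := u.scaledModular_one_le hμ hμ1.le
  rw [scaledModular_eq_ofReal u one_pos, inv_one, one_smul,
    ENNReal.ofReal_le_ofReal_iff hμ.1.le] at k
  exact k.trans hμ1.le

lemma norm_le_of_Lambda_le_one {u : W1Phi h} {μ : ℝ} (hμ : 0 < μ)
    (hu : Lambda (μ⁻¹ • u) ≤ 1) : ‖u‖ ≤ μ := by
  refine csInf_le u.normSet_bddBelow ⟨hμ, ?_⟩
  rw [scaledModular_eq_ofReal u hμ]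
  exact ENNReal.ofReal_le_one.2 hu

lemma exists_Lambda_scaling (h : IsAdmissible Ω a) (r : ℝ) :
    ∃ C : ℝ, 0 < C ∧ ∀ u : W1Phi h, Lambda (r • u) ≤ C * Lambda u := by
  obtain ⟨C, hC, hs⟩ := h.exists_density_scaling r
  refine ⟨C, hC, fun u => ?_⟩
  rw [Lambda_eq, Lambda_eq, ← integral_const_mul]
  refine integral_mono_ae (integrable_density _) (u.integrable_density.const_mul C) ?_
  filter_upwards [ae_mem Ω, jet_smul r u] with x hx h1
  rw [h1]
  exact hs x hx _

lemma Lambda_convexOn : ConvexOn ℝ Set.univ (Lambda (h := h)) := by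
  refine ⟨convex_univ, fun u _ v _ α β hα hβ hαβ => ?_⟩
  simp only [Lambda_eq, smul_eq_mul]
  rw [← integral_const_mul, ← integral_const_mul,
    ← integral_add (u.integrable_density.const_mul α) (v.integrable_density.const_mul β)]
  refine integral_mono_ae (integrable_density _)
    ((u.integrable_density.const_mul α).add (v.integrable_density.const_mul β)) ?_
  filter_upwards [ae_mem Ω, jet_add (α • u) (β • v), jet_smul α u, jet_smul β v] with x hx h1 h2 h3
  rw [h1, h2, h3]
  exact (h.density_convexOn hx).2 (Set.mem_univ _) (Set.mem_univ _) hα hβ hαβ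

lemma Lambda_clarkson (u v : W1Phi h) : Lambda (u + v) + Lambda (u - v)
    ≤ (Lambda ((2 : ℝ) • u) + Lambda ((2 : ℝ) • v)) / 2 := by
  simp only [Lambda_eq]
  rw [← integral_add (integrable_density _) (integrable_density _),
    ← integral_add (integrable_density _) (integrable_density _), ← integral_div]
  refine integral_mono_ae ((integrable_density _).add (integrable_density _))
    (((integrable_density _).add (integrable_density _)).div_const 2) ?_
  filter_upwards [ae_mem Ω, jet_add u v, jet_sub u v, jet_smul 2 u, jet_smul 2 v]
    with x hx h1 h2 h3 h4
  simp only [h1, h2, h3, h4]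
  exact h.density_clarkson hx _ _

/-- Doubling bounds `Λ` of the sequence rescaled by `2/ε` by a fixed multiple of `Λ (w n)`. Once
this is at most 1, the Luxemburg norm is at most `ε/2`. -/
lemma tendsto_zero_of_Lambda {ι : Type*} {l : Filter ι} {w : ι → W1Phi h}
    (hw : Tendsto (fun n => Lambda (w n)) l (𝓝 0)) : Tendsto w l (𝓝 0) := by
  rw [tendsto_zero_iff_norm_tendsto_zero, Metric.tendsto_nhds]
  intro ε hε
  obtain ⟨C, hC, hs⟩ := exists_Lambda_scaling h (ε / 2)⁻¹
  filter_upwards [hw.eventually (Iio_mem_nhds (inv_pos.2 hC))] with n hn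
  have k : Lambda ((ε / 2)⁻¹ • w n) ≤ 1 := by
    refine (hs (w n)).trans ?_
    rw [← mul_inv_cancel₀ hC.ne']
    exact mul_le_mul_of_nonneg_left (Set.mem_Iio.1 hn).le hC.le
  rw [dist_zero_right, norm_norm]
  exact (norm_le_of_Lambda_le_one (half_pos hε) k).trans_lt (half_lt_self hε)

end W1Phi

/-! ### Fréchet differentiability of the modular. -/

namespace W1Phi

variable {Ω : TopologicalSpace.Opens (Vec N)} {a : Vec N → ℝ → ℝ} {h : IsAdmissible Ω a}

/-- The derivative is an almost everywhere limit of difference quotients of the integrand along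
elements of the space, whose measurability is known. -/
lemma aemeasurable_fderiv_density (u k : W1Phi h) :
    AEMeasurable (fun x => fderiv ℝ (density a x) (u.jet x) (k.jet x)) (vol Ω) := by
  refine aemeasurable_of_tendsto_metrizable_ae atTop
    (f := fun (n : ℕ) x => (n : ℝ) • (density a x ((u + (n : ℝ)⁻¹ • k).jet x)
      - density a x (u.jet x)))
    (fun n => ((aemeasurable_density _).sub (aemeasurable_density _)).const_smul (n : ℝ)) ?_
  have hall : ∀ᵐ x ∂(vol Ω), ∀ n : ℕ,
      (u + (n : ℝ)⁻¹ • k).jet x = u.jet x + (n : ℝ)⁻¹ • k.jet x := by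
    refine ae_all_iff.2 fun n => ?_
    filter_upwards [jet_add u ((n : ℝ)⁻¹ • k), jet_smul (n : ℝ)⁻¹ k] with x h1 h2
    rw [h1, h2]
  filter_upwards [ae_mem Ω, hall] with x hx h1
  simp only [h1]
  refine (h.density_differentiable hx (u.jet x)).hasFDerivAt.lim (k.jet x) ?_
  simpa using tendsto_natCast_atTop_atTop (R := ℝ)

lemma ae_abs_fderiv_density_le (u k : W1Phi h) : ∀ᵐ x ∂(vol Ω),
    |fderiv ℝ (density a x) (u.jet x) (k.jet x)|
      ≤ density a x ((u + k).jet x) + density a x ((u - k).jet x) := by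
  filter_upwards [ae_mem Ω, jet_add u k, jet_sub u k] with x hx h1 h2
  rw [h1, h2]
  exact h.abs_fderiv_density_le hx _ _

lemma integrable_fderiv_density (u k : W1Phi h) :
    Integrable (fun x => fderiv ℝ (density a x) (u.jet x) (k.jet x)) (vol Ω) :=
  ((integrable_density (u + k)).add (integrable_density (u - k))).mono'
    (aemeasurable_fderiv_density u k).aestronglyMeasurable (ae_abs_fderiv_density_le u k)

/-- The Gateaux derivative of `Λ` as a linear map. -/
def LambdaDerivLin (u : W1Phi h) : W1Phi h →ₗ[ℝ] ℝ where
  toFun k := ∫ x, fderiv ℝ (density a x) (u.jet x) (k.jet x) ∂(vol Ω)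
  map_add' k l := by
    rw [← integral_add (integrable_fderiv_density u k) (integrable_fderiv_density u l)]
    refine integral_congr_ae ?_
    filter_upwards [jet_add k l] with x h1
    rw [h1, map_add]
  map_smul' r k := by
    rw [RingHom.id_apply, smul_eq_mul, ← integral_const_mul]
    refine integral_congr_ae ?_
    filter_upwards [jet_smul r k] with x h1
    rw [h1, map_smul, smul_eq_mul]

lemma LambdaDerivLin_apply (u k : W1Phi h) :
    LambdaDerivLin u k = ∫ x, fderiv ℝ (density a x) (u.jet x) (k.jet x) ∂(vol Ω) := rfl

lemma exists_LambdaDerivLin_bound (u : W1Phi h) :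
    ∃ B : ℝ, ∀ k : W1Phi h, ‖LambdaDerivLin u k‖ ≤ B * ‖k‖ := by
  obtain ⟨C, hC, hs⟩ := exists_Lambda_scaling h 2
  have hsum : ∀ p q : W1Phi h, Lambda (p + q) ≤ C * (Lambda p + Lambda q) / 2 := fun p q => by
    have := convex_add_le Lambda_convexOn p q
    linarith [hs p, hs q]
  have hball : ∀ k : W1Phi h, ‖k‖ < 1 → ‖LambdaDerivLin u k‖ ≤ C * (Lambda u + 1) := by
    intro k hk
    have h1 : ‖LambdaDerivLin u k‖ ≤ Lambda (u + k) + Lambda (u - k) := by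
      rw [LambdaDerivLin_apply, Lambda_eq, Lambda_eq,
        ← integral_add (integrable_density _) (integrable_density _)]
      exact norm_integral_le_of_norm_le ((integrable_density _).add (integrable_density _))
        (ae_abs_fderiv_density_le u k)
    have h2 := hsum u k
    have h3 := hsum u (-k)
    have h4 := mul_le_mul_of_nonneg_left (Lambda_le_one hk) hC.le
    have h5 := mul_le_mul_of_nonneg_left
      (Lambda_le_one (show ‖-k‖ < 1 by rwa [norm_neg])) hC.le
    rw [← sub_eq_add_neg] at h3
    linarith
  refine ⟨2 * (C * (Lambda u + 1)), fun k => ?_⟩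
  by_cases hk : k = 0
  · subst hk; simp
  have hk0 : 0 < ‖k‖ := norm_pos_iff.2 hk
  -- Rescaling to norm `1/2` enters the open unit ball, whence the factor 2 in the bound.
  have h1 := hball ((2 * ‖k‖)⁻¹ • k) (by
    rw [norm_smul, norm_inv, Real.norm_of_nonneg (by positivity), inv_mul_eq_div,
      div_lt_one (by positivity)]
    linarith)
  rw [map_smul, norm_smul, norm_inv, Real.norm_of_nonneg (by positivity : (0 : ℝ) ≤ 2 * ‖k‖),
    inv_mul_le_iff₀ (by positivity)] at h1
  linarith

/-- The derivative of `Λ`. -/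
def LambdaDeriv (u : W1Phi h) : W1Phi h →L[ℝ] ℝ :=
  (LambdaDerivLin u).mkContinuousOfExistsBound (exists_LambdaDerivLin_bound u)

lemma LambdaDeriv_apply (u k : W1Phi h) :
    LambdaDeriv u k = ∫ x, fderiv ℝ (density a x) (u.jet x) (k.jet x) ∂(vol Ω) := rfl

lemma aemeasurable_remainder (u k : W1Phi h) :
    AEMeasurable (fun x => remainder a x (u.jet x) (k.jet x)) (vol Ω) := by
  refine AEMeasurable.congr (((aemeasurable_density (u + k)).sub (aemeasurable_density u)).sub
    (aemeasurable_fderiv_density u k)) ?_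
  filter_upwards [jet_add u k] with x h1
  simp only [Pi.sub_apply, h1, remainder]

lemma integrable_remainder (u k : W1Phi h) :
    Integrable (fun x => remainder a x (u.jet x) (k.jet x)) (vol Ω) := by
  refine (((integrable_density (u + k)).sub (integrable_density u)).sub
    (integrable_fderiv_density u k)).congr ?_
  filter_upwards [jet_add u k] with x h1
  simp only [Pi.sub_apply, h1, remainder]

lemma Lambda_remainder (u k : W1Phi h) : Lambda (u + k) - Lambda u - LambdaDeriv u k
    = ∫ x, remainder a x (u.jet x) (k.jet x) ∂(vol Ω) := by
  have hi : Integrable (fun x => density a x ((u + k).jet x) - density a x (u.jet x)) (vol Ω) :=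
    (integrable_density (u + k)).sub (integrable_density u)
  rw [Lambda_eq, Lambda_eq, LambdaDeriv_apply,
    ← integral_sub (integrable_density _) (integrable_density _),
    ← integral_sub hi (integrable_fderiv_density u k)]
  refine integral_congr_ae ?_
  filter_upwards [jet_add u k] with x h1
  simp only [h1, remainder]

/-- The part of the remainder quotient that exceeds a small multiple of the integrand. -/
def excess (a : Vec N → ℝ → ℝ) (r s : ℝ) (x : Vec N) (z w : ℝ × Vec N) : ℝ :=
  max (remainder a x z w / s - 5 * r * density a x (s⁻¹ • w)) 0

lemma aemeasurable_excess (u k : W1Phi h) (r : ℝ) :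
    AEMeasurable (fun x => excess a r (2 * ‖k‖) x (u.jet x) (k.jet x)) (vol Ω) :=
  (((aemeasurable_remainder u k).div_const _).sub
    ((k.aemeasurable_density_smul _).const_mul _)).max aemeasurable_const

lemma integrable_excess (u k : W1Phi h) {r : ℝ} (hr0 : 0 < r) :
    Integrable (fun x => excess a r (2 * ‖k‖) x (u.jet x) (k.jet x)) (vol Ω) := by
  refine ((integrable_remainder u k).div_const (2 * ‖k‖)).mono'
    (aemeasurable_excess u k r).aestronglyMeasurable ?_
  filter_upwards [ae_mem Ω] with x hx
  rw [excess, Real.norm_of_nonneg (le_max_right _ _)]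
  have n1 := mul_nonneg hr0.le (h.density_nonneg hx ((2 * ‖k‖)⁻¹ • k.jet x))
  exact max_le (by linarith) (div_nonneg (h.remainder_nonneg hx _ _) (by positivity))

/-- Dominated convergence along `k → 0` in norm, with majorant `(C/r) density (u.jet x)`. The values
`k.jet x` need not tend to 0 pointwise; the limit holds because the remainder estimate is uniform in
the direction `w`. Using `(2 * ‖k‖)⁻¹ • k.jet x` instead of the jet of the rescaled element makes
the estimates valid at every point of `Ω`, so no null set depends on `k`. -/
lemma tendsto_integral_excess (u : W1Phi h) {r : ℝ} (hr0 : 0 < r) (hr : r ≤ 1 / 2) :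
    Tendsto (fun k : W1Phi h => ∫ x, excess a r (2 * ‖k‖) x (u.jet x) (k.jet x) ∂(vol Ω))
      (𝓝 0) (𝓝 0) := by
  obtain ⟨C, hC0, hC⟩ := h.exists_density_doubling
  have hs : Tendsto (fun k : W1Phi h => 2 * ‖k‖) (𝓝 0) (𝓝 0) := by
    have := ((continuous_norm (E := W1Phi h)).const_mul (2 : ℝ)).tendsto 0
    simpa using this
  have hlim := tendsto_integral_filter_of_dominated_convergence (μ := vol Ω) (l := 𝓝 (0 : W1Phi h))
    (F := fun k x => excess a r (2 * ‖k‖) x (u.jet x) (k.jet x)) (f := fun _ => 0)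
    (fun x => C / r * density a x (u.jet x)) ?_ ?_ (u.integrable_density.const_mul _) ?_
  · simpa using hlim
  · exact Eventually.of_forall fun k => (aemeasurable_excess u k r).aestronglyMeasurable
  · filter_upwards [hs.eventually (Iio_mem_nhds hr0)] with k hk
    filter_upwards [ae_mem Ω] with x hx
    have n0 := h.density_nonneg hx (u.jet x)
    have nb : 0 ≤ C / r * density a x (u.jet x) := by positivity
    rw [excess, Real.norm_of_nonneg (le_max_right _ _)]
    refine max_le ?_ nb
    -- For `‖k‖ = 0`, division by zero and `density_zero` make the excess vanish.
    rcases (by positivity : 0 ≤ 2 * ‖k‖).eq_or_lt with e | e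
    · simpa [← e, density_zero] using nb
    · have k1 := h.remainder_div_le hC hx (u.jet x) ((2 * ‖k‖)⁻¹ • k.jet x) e
        (Set.mem_Iio.1 hk).le hr
      rw [smul_smul, mul_inv_cancel₀ e.ne', one_smul] at k1
      have n1 := mul_nonneg hr0.le (h.density_nonneg hx ((2 * ‖k‖)⁻¹ • k.jet x))
      linarith
  · filter_upwards [ae_mem Ω] with x hx
    rw [Metric.tendsto_nhds]
    intro ε hε
    obtain ⟨δ, hδ, hle⟩ := h.exists_remainder_div_le hx (u.jet x) hr0 hr (half_pos hε)
    filter_upwards [hs.eventually (Iio_mem_nhds hδ)] with k hk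
    rw [dist_zero_right, excess, Real.norm_of_nonneg (le_max_right _ _)]
    refine (max_le ?_ (half_pos hε).le).trans_lt (half_lt_self hε)
    rcases (by positivity : 0 ≤ 2 * ‖k‖).eq_or_lt with e | e
    · simpa [← e, density_zero] using (half_pos hε).le
    · have k1 := hle _ e (Set.mem_Iio.1 hk) ((2 * ‖k‖)⁻¹ • k.jet x)
      rw [smul_smul, mul_inv_cancel₀ e.ne', one_smul] at k1
      linarith

/-- The normalised increment has norm `1/2`, hence modular at most 1, so the part subtracted in the
excess costs at most `5r`. -/
lemma integral_remainder_le (u : W1Phi h) {r : ℝ} (hr0 : 0 < r) {k : W1Phi h} (hk : k ≠ 0) :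
    (∫ x, remainder a x (u.jet x) (k.jet x) ∂(vol Ω)) / (2 * ‖k‖)
      ≤ (∫ x, excess a r (2 * ‖k‖) x (u.jet x) (k.jet x) ∂(vol Ω)) + 5 * r := by
  have hi := integrable_excess u k hr0
  have hk0 : 0 < ‖k‖ := norm_pos_iff.2 hk
  have h1 : Lambda ((2 * ‖k‖)⁻¹ • k) ≤ 1 := Lambda_le_one (by
    rw [norm_smul, norm_inv, Real.norm_of_nonneg (by positivity), inv_mul_eq_div,
      div_lt_one (by positivity)]
    linarith)
  have h2 : (∫ x, remainder a x (u.jet x) (k.jet x) ∂(vol Ω)) / (2 * ‖k‖)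
      ≤ (∫ x, excess a r (2 * ‖k‖) x (u.jet x) (k.jet x) ∂(vol Ω))
        + 5 * r * Lambda ((2 * ‖k‖)⁻¹ • k) := by
    rw [Lambda_eq, ← integral_const_mul, ← integral_div,
      ← integral_add hi ((integrable_density _).const_mul _)]
    refine integral_mono_ae ((integrable_remainder u k).div_const _)
      (hi.add ((integrable_density _).const_mul _)) ?_
    filter_upwards [jet_smul (2 * ‖k‖)⁻¹ k] with x hx
    simp only [hx]
    have := le_max_left (remainder a x (u.jet x) (k.jet x) / (2 * ‖k‖)
      - 5 * r * density a x ((2 * ‖k‖)⁻¹ • k.jet x)) 0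
    unfold excess
    linarith
  have := mul_le_mul_of_nonneg_left h1 (by positivity : 0 ≤ 5 * r)
  linarith

lemma hasFDerivAt_Lambda (u : W1Phi h) : HasFDerivAt Lambda (LambdaDeriv u) u := by
  rw [hasFDerivAt_iff_isLittleO_nhds_zero, Asymptotics.isLittleO_iff]
  intro ε hε
  -- This choice gives `5r ≤ ε/4`. With an excess integral below `ε/4`, the quotient by `2‖k‖` is at
  -- most `ε/2`, so the remainder is at most `ε‖k‖`.
  set r : ℝ := min (1 / 2) (ε / 20) with hrdef
  have hr0 : 0 < r := by positivity
  have hr : r ≤ 1 / 2 := min_le_left _ _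
  have hrε : r ≤ ε / 20 := min_le_right _ _
  filter_upwards [(tendsto_integral_excess u hr0 hr).eventually
    (Iio_mem_nhds (show 0 < ε / 4 by positivity))] with k hk
  by_cases hk0 : k = 0
  · subst hk0; simp
  have hpos : 0 < ‖k‖ := norm_pos_iff.2 hk0
  have h1 := integral_remainder_le u hr0 hk0
  have hn : 0 ≤ ∫ x, remainder a x (u.jet x) (k.jet x) ∂(vol Ω) := by
    refine integral_nonneg_of_ae ?_
    filter_upwards [ae_mem Ω] with x hx
    exact h.remainder_nonneg hx _ _
  rw [Lambda_remainder, Real.norm_of_nonneg hn]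
  have hk' : _ < ε / 4 := hk
  have h2 : (∫ x, remainder a x (u.jet x) (k.jet x) ∂(vol Ω)) / (2 * ‖k‖) ≤ ε / 2 := by
    linarith
  rw [div_le_iff₀ (by positivity)] at h2
  linarith

lemma differentiable_Lambda : Differentiable ℝ (Lambda (h := h)) := fun u =>
  (hasFDerivAt_Lambda u).differentiableAt

end W1Phi

end OrliczSobolev

end

/-! ### Strong convergence from the Clarkson inequality. -/

/-- If `uₙ ⇀ u` weakly in `E = W^{1,Φ}(Ω)` and `limsup ⟨Λ'(uₙ), uₙ - u⟩ ≤ 0`, then `uₙ → u`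
strongly in `E`. -/
theorem proposition8 {N : ℕ} {Ω : TopologicalSpace.Opens (OrliczSobolev.Vec N)}
    {a : OrliczSobolev.Vec N → ℝ → ℝ} (h : OrliczSobolev.IsAdmissible Ω a)
    (u : ℕ → OrliczSobolev.W1Phi h) (v : OrliczSobolev.W1Phi h)
    (hweak : ∀ f : OrliczSobolev.W1Phi h →L[ℝ] ℝ,
      Filter.Tendsto (fun n => f (u n)) Filter.atTop (nhds (f v)))
    (hlimsup : Filter.limsup
      (fun n => ((fderiv ℝ (OrliczSobolev.W1Phi.Lambda (h := h)) (u n) (u n - v) : ℝ) : EReal))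
      Filter.atTop ≤ 0) :
    Filter.Tendsto u Filter.atTop (nhds v) := by
  open OrliczSobolev OrliczSobolev.W1Phi in
  set D := fderiv ℝ (Lambda (h := h)) v with hD
  have hgrad : ∀ p q : W1Phi h, fderiv ℝ (Lambda (h := h)) p q ≤ Lambda (p + q) - Lambda p :=
    fun p q => convex_fderiv_le Lambda_convexOn (differentiable_Lambda p) q
  have hDn : Tendsto (fun n => D (u n - v)) atTop (𝓝 0) := by
    have := (hweak D).sub_const (D v)
    simpa only [map_sub, sub_self] using this
  have hΛ : Tendsto (fun n => Lambda ((1 / 2 : ℝ) • u n - (1 / 2 : ℝ) • v)) atTop (𝓝 0) := by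
    rw [Metric.tendsto_nhds]
    intro ε hε
    have hε' : (0 : EReal) < ((ε / 2 : ℝ) : EReal) := by exact_mod_cast half_pos hε
    filter_upwards [eventually_lt_of_limsup_lt (hlimsup.trans_lt hε'),
      hDn.eventually (Ioi_mem_nhds (show -ε < 0 by linarith))] with n hn1 hn2
    have hn1' : fderiv ℝ (Lambda (h := h)) (u n) (u n - v) < ε / 2 := by exact_mod_cast hn1
    have hn2' : -ε < D (u n - v) := hn2
    -- Gives `Λ (u n) - Λ v ≤ ⟨Λ'(u n), u n - v⟩ < ε/2`.
    have g1 := hgrad (u n) (-(u n - v))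
    rw [map_neg, show u n + -(u n - v) = v by abel] at g1
    have e2 : v + (1 / 2 : ℝ) • (u n - v) = (1 / 2 : ℝ) • u n + (1 / 2 : ℝ) • v := by
      module
    -- Gives `Λ((u n + v)/2) ≥ Λ v + D(u n - v)/2 > Λ v - ε/2`.
    have g2 := hgrad v ((1 / 2 : ℝ) • (u n - v))
    rw [e2, map_smul, smul_eq_mul, ← hD] at g2
    -- Combined with the two preceding bounds, this yields `Λ((u n - v)/2) < ε/4 + ε/2`.
    have g3 := Lambda_clarkson ((1 / 2 : ℝ) • u n) ((1 / 2 : ℝ) • v)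
    rw [smul_smul, smul_smul] at g3
    norm_num at g3 g2
    rw [map_sub] at hn2'
    rw [dist_zero_right, Real.norm_of_nonneg (Lambda_nonneg _)]
    norm_num
    linarith
  have h2 := (tendsto_zero_of_Lambda hΛ).const_smul (2 : ℝ)
  simp only [smul_sub, smul_smul] at h2
  norm_num at h2
  simpa using h2.add_const v
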